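/- **Setting.** Fix integers $K\ge 1$ (demand cycle length), $D_{\max},L_{\max},m,I\ge 0$, and a fitting rule assigning to a mean and a standard deviation $(\mu,\sigma)$ a probability distribution $\mathcal D_{\mu,\sigma}$ on $\{0,\dots,D_{\max}\}$. A *parameterization* is $\mathbf p=(h,p,\boldsymbol\zeta,\boldsymbol\tau)$ with costs $h,p\ge 0$, $\boldsymbol\zeta=(\mu_j,\sigma_j)_{0\le j<K}$, $\mu_j>0$, $\sigma_j\ge 0$, and $\boldsymbol\tau=(l,\mathbf L)$, where $l\in\{0,1\}$ says whether orders can cross and $\mathbf L=(p_0,\dots,p_{L_{\max}})$ is the probability distribution of the lead time of an order. Let $g_i=p_i/\sum_{k\ge i}p_k$ (and $g_i=1$ if the denominator is $0$). If $l=1$, lead times are i.i.d. with law $\mathbf L$. If $l=0$, there are i.i.d. $\rho_t\in\{0,\dots,L_{\max}\}$ with $\Pr(\rho_t\le i)=g_i$ (so $g$ is required to be nondecreasing), and in period $t$ exactly the outstanding orders of age at least $\rho_t$ are received; each order then has lead-time law $\mathbf L$. *The lost-sales Super-MDP.* States are $\mathbf s=(OH,\mathbf x,k)$: on-hand inventory,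 pipeline of outstanding orders placed $1,\dots,L_{\max}$ periods ago, and phase $k\in\mathbb Z/K$, with inventory position $OH+\sum_i x_i\le I$. Actions are order quantities $a\in\{0,\dots,m\}$ keeping the inventory position at most $I$. In a period, outstanding orders (including the new order, of age $0$) are received: independently with probability $g_i$ at age $i$ if $l=1$, and those of age $\ge\rho_t$ if $l=0$. The stock $y=OH+q+q^0$ is then available, where $q$ is the quantity received from earlier orders and $q^0$ that from the new order; demand $D\sim\mathcal D_{\mu_k,\sigma_k}$ occurs, the next on-hand inventory is $(y-D)^+$, and the phase becomes $k+1$. Let $f^{\mathbf p}(\cdot\mid\mathbf s,a)$ be the transition probabilities and $C^{\mathbf p}(\mathbf s,a)=\mathbb E[h(y-D)^++p(D-y)^+]$ the cost. With $C_{\max}(\mathbf p,\mathbf p')=\max_{\theta\in\{\mathbf p,\mathbf p'\}}\max_{\mathbf s,a}|C^\theta(\mathbf s,a)|$, put $$d_P(\mathbf p,\mathbf p')=\max_{\mathbf s,a}\Big\{|C^{\mathbf p}(\mathbf s,a)-C^{\mathbf p'}(\mathbf s,a)|+C_{\max}(\mathbf p,\mathbf p')\,\|f^{\mathbf p}(\cdot\mid\mathbf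 s,a)-f^{\mathbf p'}(\cdot\mid\mathbf s,a)\|_1\Big\}.$$ Let $\hat{\mathcal P}$ (the probable parameter space) be a set of parameterizations on which the Super-MDP is Lipschitz: for some constants $L_f,L_r$ and the $\ell^1$ metric $d$ on parameterizations, $|C^{\mathbf p}(\mathbf s,a)-C^{\mathbf p'}(\mathbf s,a)|\le L_r\,d(\mathbf p,\mathbf p')$ and $\|f^{\mathbf p}(\cdot\mid\mathbf s,a)-f^{\mathbf p'}(\cdot\mid\mathbf s,a)\|_1\le L_f\,d(\mathbf p,\mathbf p')$ for all $\mathbf p,\mathbf p'\in\hat{\mathcal P}$ and all $(\mathbf s,a)$. *Operation.* Let $\mathbf p\in\hat{\mathcal P}$ be the true parameterization, such that $\mu_j,\sigma_j$ are the mean and standard deviation of $\mathcal D_{\mu_j,\sigma_j}$ for every $j$. Starting with empty stock and pipeline, an order $a_t\in\{0,1,2,\dots\}$ is placed in each period $t=0,1,\dots$, measurable with respect to the information $\mathcal F_t$ available at that time, where $(\mathcal F_t)$ is a filtration. The demand $D_t\sim\mathcal D_{\mu_j,\sigma_j}$, $j=t\bmod K$, and the random variable $R_t$ driving the lead times (the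 lead time of the order of period $t$ if $l=1$, and $\rho_t$ if $l=0$) are independent of each other, the pair is independent of $\mathcal F_t$, and both are $\mathcal F_{t+1}$-measurable. Only the sales $z_t=\min(D_t,y_t)$ are observed, where $y_t$ is the stock available in period $t$. Assume that almost surely, for every phase $j$ and every $x\in\{0,\dots,D_{\max}-1\}$ which demand in phase $j$ reaches or exceeds with positive probability, $y_t>x$ for infinitely many $t\equiv j\pmod K$. *Estimator.* $h,p,l$ and $K$ are known. For each phase $j$, let $$\hat F_{t,j}(x)=1-\prod_{i\le x}\Big(1-\frac{\#\{s<t:\ s\equiv j,\ z_s=i<y_s\}}{\#\{s<t:\ s\equiv j,\ z_s\ge i,\ y_s>i\}}\Big)\quad(0\le x<D_{\max}),\qquad \hat F_{t,j}(D_{\max})=1$$ ($0/0=0$) be the Kaplan–Meier estimator, and let $\hat\mu_{t,j},\hat\sigma_{t,j}$ be its mean and standard deviation. Let $\hat{\mathbf L}_t$ be the relative frequencies of the lead times among the nonzero orders received before period $t$. As long as a phase has had no period with positive available stock, or no nonzero order has been received, arbitrary fixed provisional values are used instead. Finally, $\hat{\mathbf p}_t\in\hat{\mathcal P}$ is the resulting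 estimate $(h,p,\hat{\boldsymbol\zeta}_t,(l,\hat{\mathbf L}_t))$ if this lies in $\hat{\mathcal P}$, and otherwise an $\ell^1$-nearest point of $\hat{\mathcal P}$ with the same $h,p,l$, chosen by a fixed map $\Pi$ (such a map is assumed given; it exists when $\hat{\mathcal P}$ is compact). **Corollary (Consistency in $d_P$).** Almost surely $d_P(\mathbf p,\hat{\mathbf p}_t)\to 0$ as $t\to\infty$. Moreover the estimator is consistent: $\hat{\mathbf p}_t\in\hat{\mathcal P}$ for all $t$, and $\Pr\big(d_P(\mathbf p,\hat{\mathbf p}_t)>\varepsilon\big)\to 0$ as $t\to\infty$ for every $\varepsilon>0$. -/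

import Mathlib

open MeasureTheory ProbabilityTheory Filter Topology

noncomputable section

/-! ### Super-MDPs, parameterization distance, Lipschitz property, consistency -/

/-- The part of a Super-MDP that the notions below depend on: a (probable) parameter space inside
the type `Θ` of parameterizations and, for each parameterization, one-step costs `cost θ x` and
transition probabilities `trans θ x s'`. Here `X` is the type of (feasible) state-action pairs
and `S` the state space. -/
structure SuperMDP (Θ X S : Type) where
  space : Set Θ
  cost : Θ → X → ℝ
  trans : Θ → X → S → ℝ

namespace SuperMDP

variable {Θ X S : Type} [Fintype S]

/-- `‖f^θ(· ∣ x) - f^θ'(· ∣ x)‖₁`. -/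
def transDist (M : SuperMDP Θ X S) (θ θ' : Θ) (x : X) : ℝ :=
  ∑ s', |M.trans θ x s' - M.trans θ' x s'|

/-- `C_max(θ, θ')`; for a finite nonempty type `X` the suprema are maxima. -/
def costMax (M : SuperMDP Θ X S) (θ θ' : Θ) : ℝ :=
  max (⨆ x, |M.cost θ x|) (⨆ x, |M.cost θ' x|)

/-- The parameterization distance `d_P`; for a finite nonempty type `X` the supremum is a
maximum. -/
def paramDist (M : SuperMDP Θ X S) (θ θ' : Θ) : ℝ :=
  ⨆ x, (|M.cost θ x - M.cost θ' x| + M.costMax θ θ' * M.transDist θ θ' x)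

/-- The Super-MDP is Lipschitz for the metric `d` on parameterizations, with smoothness factors
`Lf` (transitions) and `Lr` (costs). -/
def IsLipschitz (M : SuperMDP Θ X S) (d : Θ → Θ → ℝ) (Lf Lr : ℝ) : Prop :=
  ∀ θ ∈ M.space, ∀ θ' ∈ M.space, ∀ x,
    |M.cost θ x - M.cost θ' x| ≤ Lr * d θ θ' ∧ M.transDist θ θ' x ≤ Lf * d θ θ'

/-- The sequence of estimates `est t` of `θ` is consistent: it takes values in the parameter
space and `d_P(θ, est t) → 0` in probability. -/
def IsConsistent {Ω : Type*} [MeasurableSpace Ω] (P : Measure Ω) (M : SuperMDP Θ X S) (θ : Θ)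
    (est : ℕ → Ω → Θ) : Prop :=
  (∀ t ω, est t ω ∈ M.space) ∧
    ∀ ε : ℝ, 0 < ε → Tendsto (fun t => P {ω | ε < M.paramDist θ (est t ω)}) atTop (𝓝 0)

end SuperMDP

/-! ### The periodic-review lost-sales inventory problem -/

/-- The fixed data of the problem class: cycle length `K`, largest demand `Dmax`, largest lead
time `Lmax`, largest order `m`, largest inventory position `I`, and the rule which assigns to a
mean and a standard deviation the fitted demand distribution `𝒟_{μ,σ}` on `{0, …, Dmax}`. -/
structure LostSales where
  K : ℕ
  K_pos : 0 < K
  Dmax : ℕ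
  Lmax : ℕ
  m : ℕ
  I : ℕ
  fit : ℝ → ℝ → stdSimplex ℝ (Fin (Dmax + 1))

namespace LostSales

variable (M : LostSales)

instance instNeZeroK : NeZero M.K := ⟨M.K_pos.ne'⟩

/-- A parameterization `(h, p, ζ, τ)`: holding cost, penalty cost, `ζ = (μ_j, σ_j)_j`, and
`τ = (l, L)`, where `crossing` says whether orders can cross and `lead i` is the probability that
an order has lead time `i`. -/
structure Param where
  h : ℝ
  p : ℝ
  mean : Fin M.K → ℝ
  std : Fin M.K → ℝ
  crossing : Bool
  lead : Fin (M.Lmax + 1) → ℝ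

variable {M}

/-- Probability of demand `d` in phase `j` of the cycle. -/
def demandProb (θ : M.Param) (j : Fin M.K) (d : Fin (M.Dmax + 1)) : ℝ :=
  (M.fit (θ.mean j) (θ.std j)).1 d

/-- `μ_j` and `σ_j` are the mean and the standard deviation of the demand in phase `j`. -/
def HasDemandMoments (θ : M.Param) : Prop :=
  ∀ j, ∑ d, demandProb θ j d * (d : ℝ) = θ.mean j ∧
    √(∑ d, demandProb θ j d * ((d : ℝ) - θ.mean j) ^ 2) = θ.std j

/-- Probability that an order is received at age `i` given that it was not received at a smaller
age; the value `1` when this condition has probability zero is a convention. -/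
def hazard (θ : M.Param) (i : Fin (M.Lmax + 1)) : ℝ :=
  if ∑ k ∈ Finset.Ici i, θ.lead k = 0 then 1 else θ.lead i / ∑ k ∈ Finset.Ici i, θ.lead k

/-- Well-formed parameterizations. Without order crossing, there are independent identically
distributed `ρ_t` in `{0, …, Lmax}` such that in period `t` exactly the outstanding orders of age
at least `ρ_t` are received; thus `hazard i` is the probability of `ρ_t ≤ i`, and it is
nondecreasing in `i`. -/
structure IsAdmissible (θ : M.Param) : Prop where
  h_nonneg : 0 ≤ θ.h
  p_nonneg : 0 ≤ θ.p
  mean_pos : ∀ j, 0 < θ.mean j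
  std_nonneg : ∀ j, 0 ≤ θ.std j
  lead_mem : θ.lead ∈ stdSimplex ℝ (Fin (M.Lmax + 1))
  lead_mono : θ.crossing = false → Monotone (hazard θ)

/-- The law of the random variable `R_t` which drives the lead times: with order crossing `R_t`
is the lead time of the order placed in period `t`; without order crossing it is `ρ_t`, whose
distribution function is `hazard`. -/
def driverProb (θ : M.Param) (i : Fin (M.Lmax + 1)) : ℝ :=
  if θ.crossing then θ.lead i
  else hazard θ i - ∑ k ∈ Finset.univ.filter (fun k : Fin (M.Lmax + 1) => k.val + 1 = i.val),
    hazard θ k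

/-- Probability that `B` is the set of ages whose orders are received in a period: with order
crossing the orders are received independently; without it, `B` is `{i ∣ ρ_t ≤ i}`. -/
def receiveProb (θ : M.Param) (B : Finset (Fin (M.Lmax + 1))) : ℝ :=
  if θ.crossing then ∏ i, (if i ∈ B then hazard θ i else 1 - hazard θ i)
  else ∑ r, if B = Finset.Ici r then driverProb θ r else 0

variable (M)

/-- States `(OH, x, k)`: on-hand inventory, pipeline (`x i` is the outstanding order placed
`i + 1` periods ago), phase of the cycle; the inventory position is at most `I`. -/
def State : Type :=
  {s : ℕ × (Fin M.Lmax → ℕ) × Fin M.K // s.1 + ∑ i, s.2.1 i ≤ M.I}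

instance instFiniteState : Finite M.State := by
  have h : {s : ℕ × (Fin M.Lmax → ℕ) × Fin M.K | s.1 + ∑ i, s.2.1 i ≤ M.I}.Finite := by
    refine ((Set.finite_Iic M.I).prod
      ((Set.finite_Iic (fun _ : Fin M.Lmax => M.I)).prod
        (Set.finite_univ (α := Fin M.K)))).subset ?_
    intro s hs
    simp only [Set.mem_ofPred_eq] at hs
    refine ⟨?_, ?_, trivial⟩
    · simp only [Set.mem_Iic]
      omega
    · intro i
      have := Finset.single_le_sum (f := s.2.1) (fun _ _ => Nat.zero_le _) (Finset.mem_univ i)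
      simp only at this ⊢
      omega
  exact h.to_subtype

instance instFintypeState : Fintype M.State := Fintype.ofFinite _

/-- Feasible pairs of a state and an action `a ∈ {0, …, m}`: ordering `a` keeps the inventory
position at most `I`. -/
def StateAction : Type :=
  {sa : M.State × Fin (M.m + 1) // sa.1.1.1 + ∑ i, sa.1.1.2.1 i + sa.2.val ≤ M.I}

variable {M}

/-- The orders by age, the new order having age `0`. -/
def ordersByAge (sa : M.StateAction) : Fin (M.Lmax + 1) → ℕ :=
  Fin.cons sa.1.2.val sa.1.1.1.2.1

/-- Stock `OH + q + q⁰` available for the demand, when the orders with age in `B` are received. -/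
def availableIn (sa : M.StateAction) (B : Finset (Fin (M.Lmax + 1))) : ℕ :=
  sa.1.1.1.1 + ∑ i ∈ B, ordersByAge sa i

/-- The next state, given the set `B` of ages whose orders are received and the demand `d`. -/
def next (sa : M.StateAction) (B : Finset (Fin (M.Lmax + 1))) (d : ℕ) : M.State :=
  ⟨(availableIn sa B - d,
    fun i => if i.castSucc ∈ B then 0 else ordersByAge sa i.castSucc,
    sa.1.1.1.2.2 + 1), by
    have h1 : sa.1.1.1.1 + ∑ i, ordersByAge sa i ≤ M.I := by
      have := sa.2
      simp only [ordersByAge, Fin.sum_univ_succ, Fin.cons_zero, Fin.cons_succ]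
      omega
    have h2 : ∑ i ∈ B, ordersByAge sa i + ∑ i, (if i ∈ B then 0 else ordersByAge sa i)
        = ∑ i, ordersByAge sa i := by
      rw [← Finset.sum_filter_add_sum_filter_not Finset.univ (· ∈ B) (ordersByAge sa)]
      congr 1
      · simp
      · rw [Finset.sum_filter]
        exact Finset.sum_congr rfl (fun i _ => by by_cases h : i ∈ B <;> simp [h])
    rw [Fin.sum_univ_castSucc (fun i => if i ∈ B then 0 else ordersByAge sa i)] at h2
    simp only [availableIn]
    omega⟩

/-- Expected one-step cost `h (y - D)⁺ + p (D - y)⁺`, with `y` the available stock. -/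
def cost (θ : M.Param) (sa : M.StateAction) : ℝ :=
  ∑ d, demandProb θ sa.1.1.1.2.2 d * ∑ B, receiveProb θ B *
    (θ.h * max 0 ((availableIn sa B : ℝ) - d) + θ.p * max 0 ((d : ℝ) - availableIn sa B))

open Classical in
/-- Transition probabilities `f^θ(s' ∣ s, a)`. -/
def trans (θ : M.Param) (sa : M.StateAction) (s' : M.State) : ℝ :=
  ∑ d, demandProb θ sa.1.1.1.2.2 d * ∑ B, receiveProb θ B * if next sa B d = s' then 1 else 0

variable (M) in
/-- The lost-sales Super-MDP with probable parameter space `Phat`. -/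
def superMDP (Phat : Set M.Param) : SuperMDP M.Param M.StateAction M.State where
  space := Phat
  cost := cost
  trans := trans

/-- The `ℓ¹` metric on parameterizations. -/
def dist₁ (θ θ' : M.Param) : ℝ :=
  |θ.h - θ'.h| + |θ.p - θ'.p| + ∑ j, (|θ.mean j - θ'.mean j| + |θ.std j - θ'.std j|) +
    (if θ.crossing = θ'.crossing then 0 else 1) + ∑ i, |θ.lead i - θ'.lead i|

/-! ### The system in operation -/

variable (M) in
/-- The phase of period `t`. -/
def phase (t : ℕ) : Fin M.K := ⟨t % M.K, Nat.mod_lt _ M.K_pos⟩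

/-- Lead time of the order placed in period `t`, as determined by the driving sequence `R`. -/
def leadTime (crossing : Bool) (R : ℕ → Fin (M.Lmax + 1)) (t : ℕ) : ℕ :=
  if crossing then (R t).val else sInf {j | (R (t + j)).val ≤ j}

end LostSales

/-- Quantity received in period `t` for orders `a` with lead times `ℓ`. -/
def received (a ℓ : ℕ → ℕ) (t : ℕ) : ℕ :=
  ∑ s ∈ Finset.range (t + 1), if s + ℓ s = t then a s else 0

/-- On-hand inventory at the beginning of period `t`, for demands `D`; the subtraction is
truncated at zero (lost sales). -/
def onHand (D a ℓ : ℕ → ℕ) : ℕ → ℕ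
  | 0 => 0
  | t + 1 => onHand D a ℓ t + received a ℓ t - D t

/-- Stock available for the demand of period `t`. -/
def available (D a ℓ : ℕ → ℕ) (t : ℕ) : ℕ := onHand D a ℓ t + received a ℓ t

/-- Observed sales. -/
def sales (D a ℓ : ℕ → ℕ) (t : ℕ) : ℕ := min (D t) (available D a ℓ t)

namespace LostSales

variable {M : LostSales}

/-- `𝓕 t` is the information when the order `a t` of period `t` is placed. The demand and the
lead-time driver of period `t` are independent of it and of each other, and they have the laws
given by the true parameterization `θ`. -/
structure IsOperation {Ω : Type*} [mΩ : MeasurableSpace Ω] (P : Measure Ω) (θ : M.Param)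
    (𝓕 : Filtration ℕ mΩ) (D : ℕ → Ω → Fin (M.Dmax + 1)) (R : ℕ → Ω → Fin (M.Lmax + 1))
    (a : ℕ → Ω → ℕ) : Prop where
  order_meas : ∀ t, Measurable[𝓕 t] (a t)
  demand_meas : ∀ t, Measurable[𝓕 (t + 1)] (D t)
  driver_meas : ∀ t, Measurable[𝓕 (t + 1)] (R t)
  indep_past : ∀ t, Indep (𝓕 t) (MeasurableSpace.comap (fun ω => (D t ω, R t ω)) inferInstance) P
  indep_driver : ∀ t, IndepFun (D t) (R t) P
  demand_law : ∀ t d, P.real {ω | D t ω = d} = demandProb θ (M.phase t) d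
  driver_law : ∀ t i, P.real {ω | R t ω = i} = driverProb θ i

/-! ### The estimators

They are functions of the sales `z`, the available stocks `y`, the orders `a` and the lead times
`ℓ` of received orders, in the periods before `t`. Demand is censored on a stockout: a sale
`z s = y s` only shows that the demand was at least `y s`. -/

variable (M) in
/-- Number of periods before `t` in phase `j` in which the demand was seen to be exactly `x`. -/
def eventCount (z y : ℕ → ℕ) (t : ℕ) (j : Fin M.K) (x : ℕ) : ℕ :=
  ((Finset.range t).filter fun s => M.phase s = j ∧ z s = x ∧ x < y s).card

variable (M) in
/-- Number of periods before `t` in phase `j` at risk at `x`: the demand was at least `x`, and a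
demand of `x` would have been seen. -/
def riskCount (z y : ℕ → ℕ) (t : ℕ) (j : Fin M.K) (x : ℕ) : ℕ :=
  ((Finset.range t).filter fun s => M.phase s = j ∧ x ≤ z s ∧ x < y s).card

variable (M) in
/-- Kaplan–Meier (product-limit) estimate of the demand distribution function in phase `j`;
levels with nobody at risk contribute the factor `1`, and the distribution is supported
on `{0, …, Dmax}`. -/
def kaplanMeier (z y : ℕ → ℕ) (t : ℕ) (j : Fin M.K) (x : ℕ) : ℝ :=
  if M.Dmax ≤ x then 1
  else 1 - ∏ i ∈ Finset.range (x + 1),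
    (1 - (M.eventCount z y t j i : ℝ) / (M.riskCount z y t j i : ℝ))

variable (M) in
/-- Mass that the Kaplan–Meier distribution gives to `x`. -/
def kmMass (z y : ℕ → ℕ) (t : ℕ) (j : Fin M.K) (x : ℕ) : ℝ :=
  M.kaplanMeier z y t j x - if x = 0 then 0 else M.kaplanMeier z y t j (x - 1)

variable (M) in
/-- Mean of the Kaplan–Meier distribution. -/
def kmMean (z y : ℕ → ℕ) (t : ℕ) (j : Fin M.K) : ℝ :=
  ∑ x ∈ Finset.range (M.Dmax + 1), M.kmMass z y t j x * (x : ℝ)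

variable (M) in
/-- Standard deviation of the Kaplan–Meier distribution. -/
def kmStd (z y : ℕ → ℕ) (t : ℕ) (j : Fin M.K) : ℝ :=
  √(∑ x ∈ Finset.range (M.Dmax + 1), M.kmMass z y t j x * ((x : ℝ) - M.kmMean z y t j) ^ 2)

/-- Orders received before period `t`. -/
def receivedOrders (a ℓ : ℕ → ℕ) (t : ℕ) : Finset ℕ :=
  (Finset.range t).filter fun s => 0 < a s ∧ s + ℓ s < t

open Classical in
/-- The estimates based on the observations before period `t`. The costs `h`, `p` and the
crossing indicator are known; `θ₀` supplies provisional values as long as a phase had no period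
with positive stock, or no order was received. -/
def rawEstimate (θ θ₀ : M.Param) (z y a ℓ : ℕ → ℕ) (t : ℕ) : M.Param where
  h := θ.h
  p := θ.p
  crossing := θ.crossing
  mean j := if M.riskCount z y t j 0 = 0 then θ₀.mean j else M.kmMean z y t j
  std j := if M.riskCount z y t j 0 = 0 then θ₀.std j else M.kmStd z y t j
  lead i := if (receivedOrders a ℓ t).card = 0 then θ₀.lead i
    else (((receivedOrders a ℓ t).filter fun s => ℓ s = i.val).card : ℝ) /
      ((receivedOrders a ℓ t).card : ℝ)

/-- The known components of two parameterizations agree. -/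
def SameKnown (θ θ' : M.Param) : Prop :=
  θ.h = θ'.h ∧ θ.p = θ'.p ∧ θ.crossing = θ'.crossing

/-- `proj` maps a parameterization to an `ℓ¹`-nearest one in `Phat` with the same known components
(if `Phat` has any such element); in particular it fixes `Phat`. -/
def IsProjection (Phat : Set M.Param) (proj : M.Param → M.Param) : Prop :=
  ∀ θ, (∃ θ' ∈ Phat, SameKnown θ θ') →
    proj θ ∈ Phat ∧ SameKnown θ (proj θ) ∧
      ∀ θ' ∈ Phat, SameKnown θ θ' → dist₁ θ (proj θ) ≤ dist₁ θ θ'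

/-- The estimator `p̂_t`, along the operation of the system: the estimates based on the
observations before period `t`, brought into the probable parameter space by `proj`. -/
def estimate {Ω : Type*} (θ θ₀ : M.Param) (proj : M.Param → M.Param)
    (D : ℕ → Ω → Fin (M.Dmax + 1)) (R : ℕ → Ω → Fin (M.Lmax + 1)) (a : ℕ → Ω → ℕ)
    (t : ℕ) (ω : Ω) : M.Param :=
  let d : ℕ → ℕ := fun s => (D s ω).val
  let o : ℕ → ℕ := fun s => a s ω
  let ℓ : ℕ → ℕ := leadTime θ.crossing (fun s => R s ω)
  proj (rawEstimate θ θ₀ (sales d o ℓ) (available d o ℓ) o ℓ t)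

/-- The censoring does not hide any part of the demand distribution for ever: almost surely, for
every phase `j` and every `x < Dmax` that the demand of phase `j` reaches or exceeds with positive
probability, the available stock exceeds `x` in infinitely many periods of phase `j`. -/
def IsObservable {Ω : Type*} [MeasurableSpace Ω] (P : Measure Ω) (θ : M.Param)
    (D : ℕ → Ω → Fin (M.Dmax + 1)) (R : ℕ → Ω → Fin (M.Lmax + 1)) (a : ℕ → Ω → ℕ) : Prop :=
  ∀ᵐ ω ∂P, ∀ (j : Fin M.K) (x : Fin (M.Dmax + 1)), x.val < M.Dmax →
    0 < ∑ d ∈ Finset.Ici x, demandProb θ j d →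
    ∃ᶠ t in atTop, M.phase t = j ∧
      x.val < available (fun s => (D s ω).val) (fun s => a s ω)
        (leadTime θ.crossing (fun s => R s ω)) t

end LostSales

end

/-! ### A strong law for adaptively selected periods -/

/-! Censoring, periodicity and dependence between orders rule out an i.i.d. argument, but every
count used by the estimators has the same shape: a period is selected by something already known,
and an event independent of that knowledge is then tested. `ae_abs_selectedSum_le` shows that
centred sums over the selected periods are almost surely at most `C + ε N`, with `N` the number of
selected periods. It comes from the nonnegative supermartingales `exp (c S - c² N)` with `c` of both
signs, and it requires no assumption that `N` tends to infinity.

For demand, the selected periods are those of phase `j` with stock above `x`. The stock depends on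
the current deliveries, so the filtration has to include the current lead-time driver; by
`measure_inter_eq_mul_of_sup` the demand is still independent of it. When the stock exceeds `x`,
sales reveal whether the demand equals `x` and whether it reaches `x`, so observability makes the
empirical hazards converge (`IsOperation.ae_hazardsConverge`). The Kaplan–Meier product then
telescopes to the true tail, and its moments converge.

For lead times, there must first be infinitely many nonzero orders: the mean demand is positive, so
sales occur infinitely often, and stock is conserved (`IsOperation.ae_tendsto_orderCount`). With
crossing, the driver is the lead time itself. Without crossing, the orders surviving to age `i` are
known before the driver that decides their receipt, and an induction on the age turns conditional
frequencies into the lead-time law (`IsOperation.ae_tendsto_leadCount`). Orders not yet received are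
negligible in number.

The true parameterization belongs to the probable space, so projecting at most doubles the `ℓ¹`
error, and the Lipschitz property bounds `d_P` by a continuous function of this error that vanishes
at zero. -/

section StrongLaw

open Classical in
/-- Sum of `X s ω` over the selected periods `s < t`. -/
noncomputable def selectedSum {Ω : Type*} (V : ℕ → Ω → Prop) (X : ℕ → Ω → ℝ) (t : ℕ) (ω : Ω) : ℝ :=
  ∑ s ∈ Finset.range t, if V s ω then X s ω else 0

/-- Number of selected periods `s < t`. -/
noncomputable def selectedCount {Ω : Type*} (V : ℕ → Ω → Prop) (t : ℕ) (ω : Ω) : ℝ :=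
  selectedSum V (fun _ _ => 1) t ω

lemma selectedCount_mono {Ω : Type*} (V : ℕ → Ω → Prop) (ω : Ω) :
    Monotone fun t => selectedCount V t ω := by
  refine monotone_nat_of_le_succ fun t => ?_
  simp only [selectedCount, selectedSum, Finset.sum_range_succ]
  split_ifs <;> simp

lemma selectedCount_nonneg {Ω : Type*} (V : ℕ → Ω → Prop) (t : ℕ) (ω : Ω) :
    0 ≤ selectedCount V t ω := by
  unfold selectedCount selectedSum
  refine Finset.sum_nonneg fun s _ => ?_
  split_ifs <;> simp

lemma selectedCount_eq_card {Ω : Type*} (V : ℕ → Ω → Prop) (t : ℕ) (ω : Ω)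
    [DecidablePred fun s => V s ω] :
    selectedCount V t ω = (((Finset.range t).filter fun s => V s ω).card : ℝ) := by
  rw [Finset.card_filter, Nat.cast_sum, selectedCount, selectedSum]
  refine Finset.sum_congr rfl fun s _ => ?_
  split_ifs <;> simp

/-- Translates between counting orders by the period in which they reach age `i` and counting them
by the period in which they were placed. -/
lemma selectedCount_add {Ω : Type*} {V : ℕ → Ω → Prop} {ω : Ω} {i : ℕ}
    (h : ∀ s < i, ¬ V s ω) (t : ℕ) :
    selectedCount V (t + i) ω = selectedCount (fun s ω => V (s + i) ω) t ω := by
  rw [selectedCount, selectedSum, add_comm t i, Finset.sum_range_add,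
    Finset.sum_eq_zero fun s hs => if_neg (h s (Finset.mem_range.1 hs)), zero_add]
  refine Finset.sum_congr rfl fun s _ => ?_
  rw [add_comm i s]

lemma tendsto_selectedCount {Ω : Type*} {V : ℕ → Ω → Prop} {ω : Ω}
    (h : ∃ᶠ t in atTop, V t ω) : Tendsto (fun t => selectedCount V t ω) atTop atTop := by
  refine tendsto_atTop_atTop_of_monotone (selectedCount_mono V ω) fun b => ?_
  obtain ⟨n, hn⟩ := exists_nat_ge b
  suffices ∀ n : ℕ, ∃ t, (n : ℝ) ≤ selectedCount V t ω from
    (this n).imp fun t ht => hn.trans ht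
  intro n
  induction n with
  | zero => exact ⟨0, by simpa using selectedCount_nonneg V 0 ω⟩
  | succ n ih =>
    obtain ⟨t, ht⟩ := ih
    obtain ⟨s, hs, hV⟩ := (frequently_atTop.1 h) t
    refine ⟨s + 1, ?_⟩
    have h1 := selectedCount_mono V ω hs
    have h2 : selectedCount V (s + 1) ω = selectedCount V s ω + 1 := by
      simp only [selectedCount, selectedSum, Finset.sum_range_succ, if_pos hV]
    push_cast
    simp only at h1
    linarith

variable {Ω : Type*} [mΩ : MeasurableSpace Ω] {P : Measure Ω} [IsProbabilityMeasure P]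

/-- On `|u| ≤ 1` one has `exp u ≤ 1 + u + u²`; the linear term integrates to zero, and `1 + c² ≤ exp
(c²)`. -/
lemma integral_exp_mul_le {X : Ω → ℝ} (hX : AEStronglyMeasurable X P) (hb : ∀ ω, |X ω| ≤ 1)
    (h0 : ∫ ω, X ω ∂P = 0) {c : ℝ} (hc : |c| ≤ 1) :
    ∫ ω, Real.exp (c * X ω) ∂P ≤ Real.exp (c ^ 2) := by
  have hXi : Integrable X P := Integrable.of_bound hX 1 (ae_of_all _ hb)
  have hle : ∀ ω, Real.exp (c * X ω) ≤ 1 + c * X ω + c ^ 2 := fun ω => by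
    have h1 : |c * X ω| ≤ 1 := by
      rw [abs_mul]; exact mul_le_one₀ hc (abs_nonneg _) (hb ω)
    have h2 := (abs_le.1 (Real.abs_exp_sub_one_sub_id_le h1)).2
    have h3 : (c * X ω) ^ 2 ≤ c ^ 2 := by
      rw [mul_pow]
      have : X ω ^ 2 ≤ 1 := by rw [← sq_abs]; exact pow_le_one₀ (abs_nonneg _) (hb ω)
      nlinarith [sq_nonneg c]
    linarith
  have hint : Integrable (fun ω => 1 + c * X ω + c ^ 2) P :=
    ((integrable_const 1).add (hXi.const_mul c)).add (integrable_const _)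
  calc ∫ ω, Real.exp (c * X ω) ∂P ≤ ∫ ω, (1 + c * X ω + c ^ 2) ∂P :=
        integral_mono_of_nonneg (ae_of_all _ fun _ => (Real.exp_pos _).le) hint (ae_of_all _ hle)
    _ = 1 + c ^ 2 := by
        rw [integral_add (f := fun ω => 1 + c * X ω)
            ((integrable_const 1).add (hXi.const_mul c)) (integrable_const _),
          integral_add (integrable_const 1) (hXi.const_mul c), integral_const_mul, h0]
        simp
    _ ≤ Real.exp (c ^ 2) := by linarith [Real.add_one_le_exp (c ^ 2)]

variable {𝓖 : Filtration ℕ mΩ} {V : ℕ → Ω → Prop} {X : ℕ → Ω → ℝ}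

lemma measurable_selectedSum (hV : ∀ t, MeasurableSet[𝓖 t] {ω | V t ω})
    (hX : ∀ t, Measurable[𝓖 (t + 1)] (X t)) (t : ℕ) :
    Measurable[𝓖 t] (selectedSum V X t) := by
  refine Finset.measurable_fun_sum (m := 𝓖 t) _ fun s hs => ?_
  have hs' : s + 1 ≤ t := Finset.mem_range.1 hs
  exact Measurable.ite (𝓖.mono (by omega) _ (hV s)) ((hX s).mono (𝓖.mono hs') le_rfl)
    measurable_const

/-- The exponential supermartingale of the selected sums is almost surely bounded. -/
lemma ae_bddAbove_exp_selectedSum (hV : ∀ t, MeasurableSet[𝓖 t] {ω | V t ω})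
    (hX : ∀ t, Measurable[𝓖 (t + 1)] (X t)) (hb : ∀ t ω, |X t ω| ≤ 1)
    (h0 : ∀ t, ∫ ω, X t ω ∂P = 0)
    (hind : ∀ t, Indep (MeasurableSpace.comap (X t) inferInstance) (𝓖 t) P)
    {c : ℝ} (hc : |c| ≤ 1) :
    ∀ᵐ ω ∂P, ∃ C, ∀ t, c * selectedSum V X t ω - c ^ 2 * selectedCount V t ω ≤ C := by
  classical
  set Z : ℕ → Ω → ℝ := fun t ω =>
    Real.exp (c * selectedSum V X t ω - c ^ 2 * selectedCount V t ω) with hZ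
  have hXm : ∀ t, Measurable (X t) := fun t => (hX t).mono (𝓖.le _) le_rfl
  have hmeas : ∀ t, Measurable[𝓖 t] (Z t) := fun t =>
    Real.measurable_exp.comp (((measurable_selectedSum hV hX t).const_mul c).sub
      ((measurable_selectedSum hV (fun _ => measurable_const) t).const_mul _))
  set W : ℕ → Ω → ℝ := fun t ω => if V t ω then Real.exp (c * X t ω - c ^ 2) else 1 with hW
  have hstep : ∀ t ω, Z (t + 1) ω = Z t ω * W t ω := fun t ω => by
    simp only [hZ, hW, selectedCount, selectedSum, Finset.sum_range_succ]
    split_ifs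
    · rw [← Real.exp_add]; congr 1; ring
    · simp
  have hWb : ∀ t ω, W t ω ≤ Real.exp 1 := fun t ω => by
    simp only [hW]
    have h1 : c * X t ω ≤ 1 := (le_abs_self _).trans (by
      rw [abs_mul]; exact mul_le_one₀ hc (abs_nonneg _) (hb t ω))
    split_ifs
    · exact Real.exp_le_exp.2 (by nlinarith [sq_nonneg c])
    · exact Real.one_le_exp zero_le_one
  have hZpos : ∀ t ω, 0 < Z t ω := fun t ω => Real.exp_pos _
  -- A bound growing with `t` is enough here: it only serves integrability.
  have hZb : ∀ t ω, Z t ω ≤ Real.exp 1 ^ t := fun t ω => by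
    induction t with
    | zero => simp [hZ, selectedCount, selectedSum]
    | succ t ih =>
      rw [hstep, pow_succ]
      exact mul_le_mul ih (hWb t ω) (by simp only [hW]; split_ifs <;> positivity) (by positivity)
  have hZi : ∀ t, Integrable (Z t) P := fun t =>
    Integrable.of_bound ((hmeas t).mono (𝓖.le t) le_rfl).aestronglyMeasurable (Real.exp 1 ^ t)
      (ae_of_all _ fun ω => by
        rw [Real.norm_eq_abs, abs_of_pos (hZpos t ω)]; exact hZb t ω)
  have hsup : Supermartingale Z 𝓖 P := by
    refine supermartingale_nat (fun t => (hmeas t).stronglyMeasurable) hZi fun t => ?_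
    -- Only the selected part `A` is multiplied by the new factor `E`, which is independent of `𝓖
    -- t`. The compensator `c²` is chosen so that `E` has mean at most one.
    set A : Ω → ℝ := fun ω => if V t ω then Z t ω else 0 with hA
    set B : Ω → ℝ := fun ω => if V t ω then 0 else Z t ω with hB
    set E : Ω → ℝ := fun ω => Real.exp (c * X t ω - c ^ 2) with hE
    have hAm : Measurable[𝓖 t] A := Measurable.ite (hV t) (hmeas t) measurable_const
    have hBm : Measurable[𝓖 t] B := Measurable.ite (hV t) measurable_const (hmeas t)
    have hBi : Integrable B P := (hZi t).mono (hBm.mono (𝓖.le t) le_rfl).aestronglyMeasurable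
      (ae_of_all _ fun ω => by simp only [hB]; split_ifs <;> simp)
    have hAi : Integrable A P := (hZi t).mono (hAm.mono (𝓖.le t) le_rfl).aestronglyMeasurable
      (ae_of_all _ fun ω => by simp only [hA]; split_ifs <;> simp)
    have hEc : Measurable[MeasurableSpace.comap (X t) inferInstance] E :=
      (Real.measurable_exp.comp ((measurable_id.const_mul c).sub_const _)).comp
        (comap_measurable (X t))
    have hEm : Measurable E := hEc.mono (hXm t).comap_le le_rfl
    have hEb : ∀ ω, |E ω| ≤ Real.exp 1 := fun ω => by
      have h1 : c * X t ω ≤ 1 := (le_abs_self _).trans (by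
        rw [abs_mul]; exact mul_le_one₀ hc (abs_nonneg _) (hb t ω))
      rw [abs_of_pos (Real.exp_pos _)]
      exact Real.exp_le_exp.2 (by nlinarith [sq_nonneg c])
    have hEi : Integrable E P := Integrable.of_bound hEm.aestronglyMeasurable _ (ae_of_all _ hEb)
    have hAE : Integrable (A * E) P := hAi.mul_bdd hEm.aestronglyMeasurable (ae_of_all _ hEb)
    have hdec : Z (t + 1) = B + A * E := by
      funext ω
      rw [hstep]
      simp only [hA, hB, hE, hW, Pi.add_apply, Pi.mul_apply]
      split_ifs <;> simp
    have hEle : ∫ ω, E ω ∂P ≤ 1 := by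
      have : ∀ ω, E ω = Real.exp (-c ^ 2) * Real.exp (c * X t ω) := fun ω => by
        rw [← Real.exp_add]; simp only [hE]; congr 1; ring
      simp_rw [this]
      rw [integral_const_mul]
      calc _ ≤ Real.exp (-c ^ 2) * Real.exp (c ^ 2) := by
            gcongr
            exact integral_exp_mul_le (hXm t).aestronglyMeasurable (hb t) (h0 t) hc
        _ = 1 := by rw [← Real.exp_add]; simp
    rw [hdec]
    have h1 := condExp_add hBi hAE (𝓖 t)
    have h2 := condExp_mul_of_stronglyMeasurable_left (μ := P) hAm.stronglyMeasurable hAE hEi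
    have h3 := condExp_indep_eq (μ := P) (hXm t).comap_le (𝓖.le t) hEc.stronglyMeasurable (hind t)
    have h4 := condExp_of_stronglyMeasurable (μ := P) (𝓖.le t) hBm.stronglyMeasurable hBi
    filter_upwards [h1, h2, h3] with ω e1 e2 e3
    rw [e1, Pi.add_apply, e2, Pi.mul_apply, e3, h4]
    simp only [hA, hB]
    split_ifs
    · have := hZpos t ω
      nlinarith
    · simp
  -- The submartingale `-Z` is bounded in `L¹` by `1`, since `Z` is positive, its mean decreases and
  -- `Z 0 = 1`.
  have hconv : ∀ᵐ ω ∂P, ∃ b, Tendsto (fun t => (-Z) t ω) atTop (𝓝 b) := by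
    refine hsup.neg.exists_ae_tendsto_of_bdd (R := 1) fun t => ?_
    rw [Pi.neg_apply, eLpNorm_neg, eLpNorm_one_eq_lintegral_enorm,
      ← ofReal_integral_norm_eq_lintegral_enorm (hZi t)]
    have h1 := hsup.setIntegral_le (Nat.zero_le t) MeasurableSet.univ
    simp only [setIntegral_univ] at h1
    have h2 : ∫ ω, Z 0 ω ∂P = 1 := by simp [hZ, selectedCount, selectedSum]
    simp_rw [Real.norm_eq_abs, fun ω => abs_of_pos (hZpos t ω)]
    simpa using h1.trans h2.le
  filter_upwards [hconv] with ω ⟨_, hω⟩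
  obtain ⟨b, hb'⟩ := hω.bddBelow_range
  refine ⟨-b, fun t => ?_⟩
  have h1 : b ≤ -Z t ω := hb' ⟨t, rfl⟩
  have h2 := Real.add_one_le_exp (c * selectedSum V X t ω - c ^ 2 * selectedCount V t ω)
  simp only [hZ] at h1
  linarith

/-- Centred sums over adaptively selected periods are negligible compared to the number of
selected periods. -/
theorem ae_abs_selectedSum_le (hV : ∀ t, MeasurableSet[𝓖 t] {ω | V t ω})
    (hX : ∀ t, Measurable[𝓖 (t + 1)] (X t)) (hb : ∀ t ω, |X t ω| ≤ 1)
    (h0 : ∀ t, ∫ ω, X t ω ∂P = 0)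
    (hind : ∀ t, Indep (MeasurableSpace.comap (X t) inferInstance) (𝓖 t) P) :
    ∀ᵐ ω ∂P, ∀ ε > 0, ∃ C, ∀ t, |selectedSum V X t ω| ≤ C + ε * selectedCount V t ω := by
  have key : ∀ n : ℕ, ∀ᵐ ω ∂P, ∃ C, ∀ t,
      |selectedSum V X t ω| ≤ C + 1 / ((n : ℝ) + 1) * selectedCount V t ω := by
    intro n
    set c : ℝ := 1 / ((n : ℝ) + 1) with hc
    have hc0 : 0 < c := by positivity
    have hc1 : c ≤ 1 := by
      rw [hc, div_le_one (by positivity)]; linarith [(Nat.cast_nonneg n : (0 : ℝ) ≤ n)]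
    filter_upwards [ae_bddAbove_exp_selectedSum hV hX hb h0 hind (c := c)
        (by rwa [abs_of_pos hc0]),
      ae_bddAbove_exp_selectedSum hV hX hb h0 hind (c := -c)
        (by rwa [abs_neg, abs_of_pos hc0])] with ω ⟨C₁, h₁⟩ ⟨C₂, h₂⟩
    -- Dividing by `c` turns the compensator `c² N` into the error term `c N`; the two signs of the
    -- exponent give the absolute value.
    refine ⟨max C₁ C₂ / c, fun t => ?_⟩
    have e : max C₁ C₂ / c + c * selectedCount V t ω
        = (max C₁ C₂ + c ^ 2 * selectedCount V t ω) / c := by field_simp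
    rw [e, le_div_iff₀ hc0, ← abs_of_pos hc0, ← abs_mul, abs_of_pos hc0]
    have := h₁ t
    have := h₂ t
    have := le_max_left C₁ C₂
    have := le_max_right C₁ C₂
    rw [abs_le]
    constructor <;> nlinarith
  filter_upwards [ae_all_iff.2 key] with ω hω ε hε
  obtain ⟨n, hn⟩ := exists_nat_one_div_lt hε
  obtain ⟨C, hC⟩ := hω n
  refine ⟨C, fun t => (hC t).trans ?_⟩
  have := selectedCount_nonneg V t ω
  gcongr

/-- Strong law for events: among the periods selected by `V`, the event `E`, which is independent
of the past, has asymptotic frequency `p`. -/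
theorem ae_abs_selectedCount_sub_le {E : ℕ → Ω → Prop} {p : ℕ → ℝ}
    (hV : ∀ t, MeasurableSet[𝓖 t] {ω | V t ω}) (hE : ∀ t, MeasurableSet[𝓖 (t + 1)] {ω | E t ω})
    (hp : ∀ t, P.real {ω | E t ω} = p t)
    (hind : ∀ t A, MeasurableSet[𝓖 t] A → P (A ∩ {ω | E t ω}) = P A * P {ω | E t ω})
    {q : ℝ} (hq : ∀ t ω, V t ω → p t = q) :
    ∀ᵐ ω ∂P, ∀ ε > 0, ∃ C, ∀ t,
      |selectedCount (fun t ω => V t ω ∧ E t ω) t ω - q * selectedCount V t ω|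
        ≤ C + ε * selectedCount V t ω := by
  classical
  -- Centring by `p t` rather than by `q` gives mean zero in every period; the two agree where `V`
  -- selects.
  set X : ℕ → Ω → ℝ := fun t ω => (if E t ω then 1 else 0) - p t with hX
  have hE' : ∀ t, MeasurableSet {ω | E t ω} := fun t => 𝓖.le _ _ (hE t)
  have hp0 : ∀ t, 0 ≤ p t := fun t => hp t ▸ measureReal_nonneg
  have hp1 : ∀ t, p t ≤ 1 := fun t => hp t ▸ measureReal_le_one
  have hXm : ∀ t, Measurable[𝓖 (t + 1)] (X t) := fun t =>
    (Measurable.ite (hE t) measurable_const measurable_const).sub_const _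
  have hcomap : ∀ t, MeasurableSpace.comap (X t) inferInstance ≤
      MeasurableSpace.generateFrom {{ω | E t ω}} := fun t => by
    rw [← measurable_iff_comap_le]
    have h1 : Measurable[MeasurableSpace.generateFrom {{ω | E t ω}}]
        fun ω => if E t ω then (1 : ℝ) else 0 :=
      Measurable.ite (MeasurableSpace.measurableSet_generateFrom rfl) measurable_const
        measurable_const
    exact h1.sub_const _
  have := ae_abs_selectedSum_le (P := P) (X := X) hV hXm
    (fun t ω => by
      simp only [hX]
      rw [abs_le]
      have := hp0 t
      have := hp1 t
      split_ifs <;> constructor <;> linarith)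
    (fun t => by
      have h1 : ∀ ω, X t ω = ({ω | E t ω}.indicator (fun _ => (1 : ℝ)) ω) - p t := fun ω => by
        simp [hX, Set.indicator_apply]
      simp_rw [h1]
      rw [integral_sub ((integrable_const 1).indicator (hE' t)) (integrable_const _),
        integral_indicator (hE' t)]
      simp [hp])
    (fun t => by
      refine indep_of_indep_of_le_left ?_ (hcomap t)
      refine IndepSets.indep (p1 := {{ω | E t ω}}) (p2 := {A | MeasurableSet[𝓖 t] A})
        (MeasurableSpace.generateFrom_le ?_) (𝓖.le t) (IsPiSystem.singleton _)
        (@MeasurableSpace.isPiSystem_measurableSet _ (𝓖 t)) rfl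
        (@MeasurableSpace.generateFrom_measurableSet _ (𝓖 t)).symm ?_
      · rintro _ rfl
        exact hE' t
      · rw [IndepSets_iff]
        rintro _ A rfl hA
        rw [Set.inter_comm, hind t A hA, mul_comm])
  filter_upwards [this] with ω hω ε hε
  obtain ⟨C, hC⟩ := hω ε hε
  refine ⟨C, fun t => ?_⟩
  convert hC t using 2
  simp only [selectedCount, selectedSum, Finset.mul_sum, ← Finset.sum_sub_distrib]
  refine Finset.sum_congr rfl fun s _ => ?_
  by_cases h : V s ω
  · simp [h, hX, hq s ω h]
  · simp [h]

end StrongLaw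

/-- Extending a `σ`-algebra by a random variable that is independent of `Y`. -/
lemma measure_inter_eq_mul_of_sup {Ω β γ : Type*} {m : MeasurableSpace Ω} [mΩ : MeasurableSpace Ω]
    {P : Measure Ω} [IsProbabilityMeasure P] [MeasurableSpace β] [MeasurableSpace γ]
    (hm : m ≤ mΩ) {X : Ω → β} {Y : Ω → γ} (hX : Measurable X) (hY : Measurable Y)
    (hpast : Indep m (MeasurableSpace.comap (fun ω => (X ω, Y ω)) inferInstance) P)
    (hXY : IndepFun X Y P) {s : Set β} (hs : MeasurableSet s) {A : Set Ω}
    (hA : MeasurableSet[m ⊔ MeasurableSpace.comap Y inferInstance] A) :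
    P (A ∩ X ⁻¹' s) = P A * P (X ⁻¹' s) := by
  -- These rectangles form a π-system generating the enlarged `σ`-algebra, so independence need only
  -- be checked on them.
  set C : Set (Set Ω) :=
    {U | ∃ B T, MeasurableSet[m] B ∧ MeasurableSet T ∧ U = B ∩ Y ⁻¹' T} with hC
  have hpi : IsPiSystem C := by
    rintro _ ⟨B, T, hB, hT, rfl⟩ _ ⟨B', T', hB', hT', rfl⟩ -
    exact ⟨B ∩ B', T ∩ T', hB.inter hB', hT.inter hT', by
      rw [Set.preimage_inter, Set.inter_inter_inter_comm]⟩
  have hgen : m ⊔ MeasurableSpace.comap Y inferInstance = MeasurableSpace.generateFrom C := by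
    refine le_antisymm (sup_le ?_ ?_) (MeasurableSpace.generateFrom_le ?_)
    · intro B hB
      exact MeasurableSpace.measurableSet_generateFrom
        ⟨B, Set.univ, hB, MeasurableSet.univ, by simp⟩
    · rintro _ ⟨T, hT, rfl⟩
      exact MeasurableSpace.measurableSet_generateFrom
        ⟨Set.univ, T, MeasurableSet.univ, hT, by simp⟩
    · rintro _ ⟨B, T, hB, hT, rfl⟩
      exact MeasurableSet.inter ((le_sup_left : m ≤ _) _ hB)
        ((le_sup_right : MeasurableSpace.comap Y inferInstance ≤ _) _ ⟨T, hT, rfl⟩)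
  have hle : m ⊔ MeasurableSpace.comap Y inferInstance ≤ mΩ := sup_le hm hY.comap_le
  have hind : Indep (m ⊔ MeasurableSpace.comap Y inferInstance)
      (MeasurableSpace.comap X inferInstance) P := by
    refine IndepSets.indep hle hX.comap_le hpi
      (@MeasurableSpace.isPiSystem_measurableSet _ (MeasurableSpace.comap X inferInstance)) hgen
      (@MeasurableSpace.generateFrom_measurableSet _
        (MeasurableSpace.comap X inferInstance)).symm ?_
    rw [IndepSets_iff]
    rintro _ _ ⟨B, T, hB, hT, rfl⟩ ⟨S, hS, rfl⟩
    rw [Indep_iff] at hpast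
    have h1 := hpast B _ hB ⟨S ×ˢ T, hS.prod hT, rfl⟩
    have h2 := hpast B _ hB ⟨Set.univ ×ˢ T, MeasurableSet.univ.prod hT, rfl⟩
    have e1 : (fun ω => (X ω, Y ω)) ⁻¹' (S ×ˢ T) = X ⁻¹' S ∩ Y ⁻¹' T := rfl
    have e2 : (fun ω => (X ω, Y ω)) ⁻¹' (Set.univ ×ˢ T) = Y ⁻¹' T := by ext; simp
    rw [e1, hXY.measure_inter_preimage_eq_mul S T hS hT] at h1
    rw [e2] at h2
    rw [h2, Set.inter_assoc, Set.inter_comm (Y ⁻¹' T), h1]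
    ring
  exact (Indep_iff _ _ _).1 hind A _ hA ⟨s, hs, rfl⟩

/-! ### Limits of frequencies -/

/-- The error is compared with the larger count `N`, so `S` may stay bounded. This covers ages that
only finitely many orders reach. -/
lemma tendsto_sub_div_of_forall_le {B S N : ℕ → ℝ} {q : ℝ} (hN : Tendsto N atTop atTop)
    (hSN : ∀ t, S t ≤ N t)
    (h : ∀ ε > 0, ∃ C, ∀ t, |B t - q * S t| ≤ C + ε * S t) :
    Tendsto (fun t => (B t - q * S t) / N t) atTop (𝓝 0) := by
  rw [Metric.tendsto_atTop]
  intro ε hε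
  obtain ⟨C, hC⟩ := h (ε / 2) (by positivity)
  obtain ⟨T, hT⟩ := eventually_atTop.1 ((hN.eventually_gt_atTop (2 * C / ε)).and
    (hN.eventually_gt_atTop 0))
  refine ⟨T, fun t ht => ?_⟩
  obtain ⟨h1, h2⟩ := hT t ht
  rw [Real.dist_eq, sub_zero, abs_div, abs_of_pos h2, div_lt_iff₀ h2]
  rw [div_lt_iff₀ hε] at h1
  have := hC t
  have := mul_le_mul_of_nonneg_left (hSN t) hε.le
  linarith

lemma tendsto_div_of_forall_le {B N : ℕ → ℝ} {q : ℝ} (hN : Tendsto N atTop atTop)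
    (h : ∀ ε > 0, ∃ C, ∀ t, |B t - q * N t| ≤ C + ε * N t) :
    Tendsto (fun t => B t / N t) atTop (𝓝 q) := by
  have h1 := (tendsto_sub_div_of_forall_le hN (fun _ => le_rfl) h).add_const q
  rw [zero_add] at h1
  refine h1.congr' ?_
  filter_upwards [hN.eventually_gt_atTop 0] with t ht
  field_simp
  ring

lemma tendsto_div_of_tendsto_div {e r N : ℕ → ℝ} {p q : ℝ} (hN : Tendsto N atTop atTop)
    (he : Tendsto (fun t => e t / N t) atTop (𝓝 p))
    (hr : Tendsto (fun t => r t / N t) atTop (𝓝 q)) (hq : q ≠ 0) :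
    Tendsto (fun t => e t / r t) atTop (𝓝 (p / q)) := by
  refine (he.div hr hq).congr' ?_
  filter_upwards [hN.eventually_gt_atTop 0] with t ht
  exact div_div_div_cancel_right₀ ht.ne' _ _

/-- Product-limit formula for converging hazards of a survival function `S`. -/
lemma tendsto_prod_one_sub_div {e r : ℕ → ℕ → ℝ} {S : ℕ → ℝ} (h0 : S 0 = 1)
    (he : ∀ i t, 0 ≤ e i t) (her : ∀ i t, e i t ≤ r i t)
    (hS : ∀ i, S i = 0 → S (i + 1) = 0) {n : ℕ}
    (h : ∀ i < n, S i ≠ 0 → Tendsto (fun t => e i t / r i t) atTop (𝓝 (1 - S (i + 1) / S i))) :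
    Tendsto (fun t => ∏ i ∈ Finset.range n, (1 - e i t / r i t)) atTop (𝓝 (S n)) := by
  induction n with
  | zero => simp [h0]
  | succ n ih =>
    have ih := ih fun i hi => h i (by omega)
    simp_rw [Finset.prod_range_succ]
    -- Where the survival function vanishes nothing is known about the ratio, but the new factor
    -- lies in `[0, 1]` (also for `0/0 = 0`), and the preceding product already tends to zero.
    by_cases hn : S n = 0
    · rw [hS n hn]
      rw [hn] at ih
      have ih' := ih.norm
      rw [norm_zero] at ih'
      refine squeeze_zero_norm (fun t => ?_) ih'
      rw [norm_mul]
      refine mul_le_of_le_one_right (norm_nonneg _) ?_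
      have h1 : e n t / r n t ≤ 1 := div_le_one_of_le₀ (her n t) ((he n t).trans (her n t))
      have h2 : 0 ≤ e n t / r n t := div_nonneg (he n t) ((he n t).trans (her n t))
      rw [Real.norm_eq_abs, abs_le]
      constructor <;> linarith
    · have := ih.mul ((h n (by omega) hn).const_sub 1)
      rwa [sub_sub_cancel, mul_div_cancel₀ _ hn] at this

namespace LostSales

variable {M : LostSales}

/-! ### The Kaplan–Meier estimator -/

/-- Probability that the demand in phase `j` reaches or exceeds `x`. -/
noncomputable def demandTail (θ : M.Param) (j : Fin M.K) (x : ℕ) : ℝ :=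
  ∑ d : Fin (M.Dmax + 1), if x ≤ d.val then demandProb θ j d else 0

lemma demandProb_nonneg (θ : M.Param) (j : Fin M.K) (d : Fin (M.Dmax + 1)) :
    0 ≤ demandProb θ j d := (M.fit (θ.mean j) (θ.std j)).2.1 d

lemma sum_demandProb (θ : M.Param) (j : Fin M.K) : ∑ d, demandProb θ j d = 1 :=
  (M.fit (θ.mean j) (θ.std j)).2.2

lemma demandTail_zero (θ : M.Param) (j : Fin M.K) : demandTail θ j 0 = 1 := by
  simp [demandTail, sum_demandProb]

lemma demandTail_nonneg (θ : M.Param) (j : Fin M.K) (x : ℕ) : 0 ≤ demandTail θ j x :=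
  Finset.sum_nonneg fun d _ => by
    split_ifs
    · exact demandProb_nonneg θ j d
    · exact le_rfl

lemma demandTail_anti (θ : M.Param) (j : Fin M.K) : Antitone (demandTail θ j) := by
  intro x y hxy
  refine Finset.sum_le_sum fun d _ => ?_
  have := demandProb_nonneg θ j d
  split_ifs
  · exact le_rfl
  · omega
  · exact this
  · exact le_rfl

lemma demandTail_succ_eq_zero {θ : M.Param} {j : Fin M.K} {x : ℕ} (h : demandTail θ j x = 0) :
    demandTail θ j (x + 1) = 0 :=
  le_antisymm (h ▸ demandTail_anti θ j (Nat.le_succ x)) (demandTail_nonneg θ j _)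

lemma demandTail_of_Dmax_lt (θ : M.Param) (j : Fin M.K) {x : ℕ} (hx : M.Dmax < x) :
    demandTail θ j x = 0 :=
  Finset.sum_eq_zero fun d _ => if_neg (by have := d.isLt; omega)

lemma demandTail_sub_succ (θ : M.Param) (j : Fin M.K) (d : Fin (M.Dmax + 1)) :
    demandTail θ j d - demandTail θ j (d + 1) = demandProb θ j d := by
  simp only [demandTail, ← Finset.sum_sub_distrib]
  rw [Finset.sum_eq_single d]
  · simp
  · intro b _ hb
    have : b.val ≠ d.val := fun h => hb (Fin.ext h)
    split_ifs <;> first | omega | simp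
  · simp

lemma demandTail_eq_sum_Ici (θ : M.Param) (j : Fin M.K) (d : Fin (M.Dmax + 1)) :
    demandTail θ j d = ∑ k ∈ Finset.Ici d, demandProb θ j k := by
  rw [demandTail, ← Finset.sum_filter]
  refine Finset.sum_congr ?_ fun _ _ => rfl
  ext k
  rw [Finset.mem_filter, Finset.mem_Ici, Fin.le_def]
  exact and_iff_right (Finset.mem_univ k)

lemma eventCount_le_riskCount (z y : ℕ → ℕ) (t : ℕ) (j : Fin M.K) (x : ℕ) :
    M.eventCount z y t j x ≤ M.riskCount z y t j x :=
  Finset.card_le_card fun s hs => by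
    simp only [Finset.mem_filter] at hs ⊢
    exact ⟨hs.1, hs.2.1, hs.2.2.1.ge, hs.2.2.2⟩

/-- Convergence of the observed hazards at every level that the demand reaches. -/
def HazardsConverge (θ : M.Param) (z y : ℕ → ℕ) : Prop :=
  ∀ j, ∀ x < M.Dmax, demandTail θ j x ≠ 0 →
    Tendsto (fun t => (M.eventCount z y t j x : ℝ) / (M.riskCount z y t j x : ℝ)) atTop
      (𝓝 (1 - demandTail θ j (x + 1) / demandTail θ j x))

variable {θ : M.Param} {z y : ℕ → ℕ}

lemma HazardsConverge.tendsto_kaplanMeier (h : HazardsConverge θ z y) (j : Fin M.K) (x : ℕ) :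
    Tendsto (fun t => M.kaplanMeier z y t j x) atTop (𝓝 (1 - demandTail θ j (x + 1))) := by
  unfold kaplanMeier
  split_ifs with hx
  · rw [demandTail_of_Dmax_lt θ j (by omega), sub_zero]
    exact tendsto_const_nhds
  · refine (tendsto_prod_one_sub_div (S := demandTail θ j)
      (e := fun i t => (M.eventCount z y t j i : ℝ)) (r := fun i t => (M.riskCount z y t j i : ℝ))
      (demandTail_zero θ j) (fun i t => Nat.cast_nonneg _)
      (fun i t => Nat.cast_le.2 (eventCount_le_riskCount z y t j i))
      (fun i => demandTail_succ_eq_zero) fun i hi hS => h j i (by omega) hS).const_sub 1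

lemma HazardsConverge.tendsto_kmMass (h : HazardsConverge θ z y) (j : Fin M.K)
    (d : Fin (M.Dmax + 1)) :
    Tendsto (fun t => M.kmMass z y t j d) atTop (𝓝 (demandProb θ j d)) := by
  unfold kmMass
  rw [← demandTail_sub_succ]
  split_ifs with h0
  · have := h.tendsto_kaplanMeier j d
    simp only [h0, zero_add, sub_zero, demandTail_zero] at this ⊢
    exact this
  · have h1 := (h.tendsto_kaplanMeier j d).sub (h.tendsto_kaplanMeier j (d - 1))
    rw [Nat.sub_add_cancel (by omega), sub_sub_sub_cancel_left] at h1
    exact h1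

lemma HazardsConverge.tendsto_kmMean (h : HazardsConverge θ z y) (hmom : HasDemandMoments θ)
    (j : Fin M.K) : Tendsto (fun t => M.kmMean z y t j) atTop (𝓝 (θ.mean j)) := by
  unfold kmMean
  simp_rw [Finset.sum_range]
  rw [← (hmom j).1]
  exact tendsto_finsetSum _ fun d _ => (h.tendsto_kmMass j d).mul_const _

lemma HazardsConverge.tendsto_kmStd (h : HazardsConverge θ z y) (hmom : HasDemandMoments θ)
    (j : Fin M.K) : Tendsto (fun t => M.kmStd z y t j) atTop (𝓝 (θ.std j)) := by
  unfold kmStd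
  simp_rw [Finset.sum_range]
  rw [← (hmom j).2]
  exact (tendsto_finsetSum _ fun d _ => (h.tendsto_kmMass j d).mul
    (((h.tendsto_kmMean hmom j).const_sub _).pow 2)).sqrt

/-! ### Lead times -/

/-- The lead time is the first age at which the driver permits receipt, and age `Lmax` always does.
Survival to age `i` thus involves only drivers before period `s + i`. -/
lemma le_leadTime_false_iff {R : ℕ → Fin (M.Lmax + 1)} {s i : ℕ} :
    i ≤ leadTime false R s ↔ ∀ k < i, k < (R (s + k)).val := by
  have hne : {j | (R (s + j)).val ≤ j}.Nonempty :=
    ⟨M.Lmax, Nat.lt_succ_iff.1 (R (s + M.Lmax)).isLt⟩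
  simp only [leadTime, Bool.false_eq_true, if_false]
  constructor
  · intro h k hk
    by_contra hcon
    have := Nat.sInf_le (s := {j | (R (s + j)).val ≤ j}) (m := k) (not_lt.1 hcon)
    omega
  · intro h
    by_contra hcon
    have h1 := h _ (not_le.1 hcon)
    have h2 : (R (s + sInf {j | (R (s + j)).val ≤ j})).val ≤ sInf {j | (R (s + j)).val ≤ j} :=
      Nat.sInf_mem hne
    omega

/-- Separates a condition on the past from a test of the single fresh driver of period `s + i`, as
the strong law requires. -/
lemma leadTime_false_eq_iff {R : ℕ → Fin (M.Lmax + 1)} {s i : ℕ} :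
    leadTime false R s = i ↔ (∀ k < i, k < (R (s + k)).val) ∧ (R (s + i)).val ≤ i := by
  rw [← le_leadTime_false_iff, le_antisymm_iff, and_comm]
  refine and_congr_right fun h => ?_
  rw [← not_lt, ← Nat.succ_le_iff, le_leadTime_false_iff, Nat.succ_eq_add_one]
  rw [le_leadTime_false_iff] at h
  constructor
  · intro h1
    by_contra hcon
    refine h1 fun k hk => ?_
    rcases Nat.lt_succ_iff_lt_or_eq.1 hk with h2 | rfl
    · exact h k h2
    · exact not_le.1 hcon
  · intro h1 h2
    have := h2 i (by omega)
    omega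

lemma leadTime_le (b : Bool) (R : ℕ → Fin (M.Lmax + 1)) (s : ℕ) : leadTime b R s ≤ M.Lmax := by
  cases b
  · by_contra hcon
    have := le_leadTime_false_iff.1 (not_le.1 hcon) M.Lmax (by omega)
    have := (R (s + M.Lmax)).isLt
    omega
  · simpa [leadTime] using Nat.lt_succ_iff.1 (R s).isLt

/-- Number of nonzero orders before `T` with lead time `i`. -/
def leadCount (a ℓ : ℕ → ℕ) (i T : ℕ) : ℕ :=
  ((Finset.range T).filter fun s => 0 < a s ∧ ℓ s = i).card

/-- Number of nonzero orders before `T`. -/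
def orderCount (a : ℕ → ℕ) (T : ℕ) : ℕ := ((Finset.range T).filter fun s => 0 < a s).card

/-- Once the lead time is fixed at `i`, receipt before `t` is only a bound on the placement period.
This removes the bias of the received sample towards short lead times. -/
lemma card_receivedOrders_filter (a ℓ : ℕ → ℕ) (t i : ℕ) :
    ((receivedOrders a ℓ t).filter fun s => ℓ s = i).card = leadCount a ℓ i (t - i) := by
  unfold receivedOrders leadCount
  congr 1
  ext s
  simp only [Finset.mem_filter, Finset.mem_range]
  constructor
  · rintro ⟨⟨h1, h2, h3⟩, h4⟩
    exact ⟨by omega, h2, h4⟩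
  · rintro ⟨h1, h2, h4⟩
    exact ⟨⟨by omega, h2, by omega⟩, h4⟩

lemma leadCount_le_sub_add (a ℓ : ℕ → ℕ) (t i : ℕ) :
    leadCount a ℓ i t ≤ leadCount a ℓ i (t - i) + i := by
  have h : (Finset.range t).filter (fun s => 0 < a s ∧ ℓ s = i) ⊆
      (Finset.range (t - i)).filter (fun s => 0 < a s ∧ ℓ s = i) ∪ Finset.Ico (t - i) t := by
    intro s hs
    simp only [Finset.mem_union, Finset.mem_filter, Finset.mem_range, Finset.mem_Ico] at hs ⊢
    by_cases h : s < t - i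
    · exact Or.inl ⟨h, hs.2⟩
    · exact Or.inr ⟨by omega, hs.1⟩
  refine (Finset.card_le_card h).trans ((Finset.card_union_le _ _).trans ?_)
  rw [Nat.card_Ico]
  unfold leadCount
  omega

lemma leadCount_sub_le (a ℓ : ℕ → ℕ) (t i : ℕ) :
    leadCount a ℓ i (t - i) ≤ leadCount a ℓ i t :=
  Finset.card_le_card (Finset.filter_subset_filter _ (Finset.range_mono (Nat.sub_le t i)))

lemma card_receivedOrders {a ℓ : ℕ → ℕ} {L : ℕ} (hℓ : ∀ s, ℓ s ≤ L) (t : ℕ) :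
    (receivedOrders a ℓ t).card = ∑ i : Fin (L + 1), leadCount a ℓ i (t - i) := by
  simp_rw [← card_receivedOrders_filter]
  rw [← Finset.sum_range (fun i => ((receivedOrders a ℓ t).filter fun s => ℓ s = i).card)]
  exact Finset.card_eq_sum_card_fiberwise fun s _ => by
    simpa [Nat.lt_succ_iff] using hℓ s

/-- Lead-time frequencies among all nonzero orders carry over to the received orders. -/
lemma tendsto_lead_frequency {a ℓ : ℕ → ℕ} {L : ℕ} (hℓ : ∀ s, ℓ s ≤ L)
    {p : Fin (L + 1) → ℝ} (hp : ∑ i, p i = 1)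
    (hN : Tendsto (fun t => (orderCount a t : ℝ)) atTop atTop)
    (h : ∀ i : Fin (L + 1),
      Tendsto (fun t => (leadCount a ℓ i t : ℝ) / (orderCount a t : ℝ)) atTop (𝓝 (p i))) :
    (∀ᶠ t in atTop, (receivedOrders a ℓ t).card ≠ 0) ∧
    ∀ i : Fin (L + 1), Tendsto (fun t =>
      (((receivedOrders a ℓ t).filter fun s => ℓ s = i.val).card : ℝ) /
        ((receivedOrders a ℓ t).card : ℝ)) atTop (𝓝 (p i)) := by
  -- Dropping the last `i` periods loses at most `i` orders, negligible against the diverging number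
  -- of orders.
  have h1 : ∀ i : Fin (L + 1), Tendsto (fun t =>
      (leadCount a ℓ i (t - i) : ℝ) / (orderCount a t : ℝ)) atTop (𝓝 (p i)) := fun i => by
    have hsm : Tendsto (fun t => (i : ℝ) / (orderCount a t : ℝ)) atTop (𝓝 0) :=
      tendsto_const_nhds.div_atTop hN
    refine tendsto_of_tendsto_of_tendsto_of_le_of_le (by simpa using (h i).sub hsm) (h i)
      (fun t => ?_) fun t => ?_
    · dsimp only
      rw [← sub_div]
      have : (leadCount a ℓ i t : ℝ) ≤ leadCount a ℓ i (t - i) + i := by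
        exact_mod_cast leadCount_le_sub_add a ℓ t i
      gcongr
      linarith
    · have : (leadCount a ℓ i (t - i) : ℝ) ≤ leadCount a ℓ i t := by
        exact_mod_cast leadCount_sub_le a ℓ t i
      dsimp only
      gcongr
  have h2 : Tendsto (fun t => ((receivedOrders a ℓ t).card : ℝ) / (orderCount a t : ℝ)) atTop
      (𝓝 1) := by
    simp_rw [card_receivedOrders hℓ, Nat.cast_sum, Finset.sum_div]
    rw [← hp]
    exact tendsto_finsetSum _ fun i _ => h1 i
  refine ⟨?_, fun i => ?_⟩
  · filter_upwards [h2.eventually (lt_mem_nhds one_pos)] with t ht h0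
    simp [h0] at ht
  · simp_rw [card_receivedOrders_filter]
    simpa using tendsto_div_of_tendsto_div hN (h1 i) h2 one_ne_zero

/-- Probability that a lead time is at least `i`. -/
noncomputable def leadTail (θ : M.Param) (i : ℕ) : ℝ :=
  ∑ k : Fin (M.Lmax + 1), if i ≤ k.val then θ.lead k else 0

lemma leadTail_eq_sum_Ici (θ : M.Param) (i : Fin (M.Lmax + 1)) :
    leadTail θ i = ∑ k ∈ Finset.Ici i, θ.lead k := by
  rw [leadTail, ← Finset.sum_filter]
  refine Finset.sum_congr ?_ fun _ _ => rfl
  ext k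
  rw [Finset.mem_filter, Finset.mem_Ici, Fin.le_def]
  exact and_iff_right (Finset.mem_univ k)

lemma leadTail_sub_succ (θ : M.Param) (i : Fin (M.Lmax + 1)) :
    leadTail θ i - leadTail θ (i + 1) = θ.lead i := by
  simp only [leadTail, ← Finset.sum_sub_distrib]
  rw [Finset.sum_eq_single i]
  · simp
  · intro b _ hb
    have : b.val ≠ i.val := fun h => hb (Fin.ext h)
    split_ifs <;> first | omega | simp
  · simp

/-- The conventional hazard `1` is harmless: where the tail vanishes, nonnegativity forces the
lead-time probability to vanish too. -/
lemma hazard_mul_leadTail (hθ : θ.lead ∈ stdSimplex ℝ (Fin (M.Lmax + 1)))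
    (i : Fin (M.Lmax + 1)) : hazard θ i * leadTail θ i = θ.lead i := by
  unfold hazard
  rw [← leadTail_eq_sum_Ici]
  split_ifs with h
  · rw [h, mul_zero]
    rw [leadTail_eq_sum_Ici, Finset.sum_eq_zero_iff_of_nonneg fun k _ => hθ.1 k] at h
    exact (h i (by simp)).symm
  · exact div_mul_cancel₀ _ h

end LostSales

/-! ### Conservation of stock -/

lemma onHand_add_sum_sales (D a ℓ : ℕ → ℕ) (t : ℕ) :
    onHand D a ℓ t + ∑ s ∈ Finset.range t, sales D a ℓ s
      = ∑ s ∈ Finset.range t, received a ℓ s := by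
  induction t with
  | zero => simp [onHand]
  | succ t ih =>
    rw [Finset.sum_range_succ, Finset.sum_range_succ, ← ih]
    simp only [onHand, sales, available]
    omega

/-- Each order is received in exactly one period, so exchanging the sums counts it at most once. -/
lemma sum_received_le (a ℓ : ℕ → ℕ) (t : ℕ) :
    ∑ s ∈ Finset.range t, received a ℓ s ≤ ∑ s ∈ Finset.range t, a s := by
  suffices h : ∑ u ∈ Finset.range t, received a ℓ u
      = ∑ s ∈ Finset.range t, if s + ℓ s < t then a s else 0 by
    rw [h]
    exact Finset.sum_le_sum fun s _ => by split_ifs <;> simp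
  induction t with
  | zero => simp
  | succ t ih =>
    rw [Finset.sum_range_succ, ih, received, Finset.sum_range_succ, Finset.sum_range_succ,
      ← add_assoc, ← Finset.sum_add_distrib]
    congr 1
    · refine Finset.sum_congr rfl fun s _ => ?_
      split_ifs <;> omega
    · split_ifs <;> omega

/-- If positive sales occur infinitely often, then so do nonzero orders. -/
lemma frequently_order_pos {D a ℓ : ℕ → ℕ} (h : ∃ᶠ t in atTop, 0 < sales D a ℓ t) :
    ∃ᶠ t in atTop, 0 < a t := by
  intro hcon
  obtain ⟨T, hT⟩ := eventually_atTop.1 hcon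
  -- If no order were placed from `T` on, total sales could never exceed the finite amount ordered
  -- before `T`.
  have hbound : ∀ t, ∑ s ∈ Finset.range t, sales D a ℓ s ≤ ∑ s ∈ Finset.range T, a s := fun t => by
    have h1 := onHand_add_sum_sales D a ℓ t
    have h2 := sum_received_le a ℓ t
    have h3 : ∑ s ∈ Finset.range t, a s ≤ ∑ s ∈ Finset.range T, a s := by
      refine Finset.sum_le_sum_of_ne_zero fun s _ hs => Finset.mem_range.2 ?_
      by_contra hc
      exact hT s (not_lt.1 hc) (Nat.pos_of_ne_zero hs)
    omega
  obtain ⟨t, ht⟩ := ((tendsto_selectedCount (V := fun t (_ : Unit) => 0 < sales D a ℓ t)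
    (ω := ()) h).eventually_gt_atTop ((∑ s ∈ Finset.range T, a s : ℕ) : ℝ)).exists
  refine ht.not_ge ((?_ : _ ≤ ((∑ s ∈ Finset.range t, sales D a ℓ s : ℕ) : ℝ)).trans
    (Nat.cast_le.2 (hbound t)))
  unfold selectedCount selectedSum
  push_cast
  refine Finset.sum_le_sum fun s _ => ?_
  split_ifs with hs
  · exact_mod_cast hs
  · positivity

namespace LostSales

variable {M : LostSales}

/-! ### Measurability of the operation -/

section Measurability

variable {Ω : Type*} {m : MeasurableSpace Ω} {D : ℕ → Ω → Fin (M.Dmax + 1)}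
  {R : ℕ → Ω → Fin (M.Lmax + 1)} {a : ℕ → Ω → ℕ}

lemma measurableSet_lt_driver {k u : ℕ} (hR : Measurable (R u)) :
    MeasurableSet {ω | k < (R u ω).val} :=
  hR (Set.toFinite {r : Fin (M.Lmax + 1) | k < r.val}).measurableSet

lemma measurableSet_leadTime_eq (b : Bool) {s i : ℕ} (hR : ∀ u ≤ s + i, Measurable (R u)) :
    MeasurableSet {ω | leadTime b (fun u => R u ω) s = i} := by
  cases b
  · simp only [leadTime_false_eq_iff]
    have h1 : MeasurableSet {ω | ∀ k < i, k < (R (s + k) ω).val} := by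
      simp only [Set.ofPred_forall]
      exact MeasurableSet.iInter fun k => MeasurableSet.iInter fun hk =>
        measurableSet_lt_driver (hR _ (by omega))
    exact h1.inter (hR (s + i) le_rfl
      (Set.toFinite {r : Fin (M.Lmax + 1) | r.val ≤ i}).measurableSet)
  · simp only [leadTime, if_true]
    exact hR s (by omega) (Set.toFinite {r : Fin (M.Lmax + 1) | r.val = i}).measurableSet

/-- Lead times may depend on drivers after `t`, but whether an order arrives exactly in period `t`
is decided by the drivers up to `t`. -/
lemma measurable_received (b : Bool) {t : ℕ} (hR : ∀ u ≤ t, Measurable (R u))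
    (ha : ∀ u ≤ t, Measurable (a u)) :
    Measurable fun ω => received (fun s => a s ω) (leadTime b fun s => R s ω) t := by
  unfold received
  refine Finset.measurable_fun_sum _ fun s hs => ?_
  have hst : s ≤ t := Nat.lt_succ_iff.1 (Finset.mem_range.1 hs)
  refine Measurable.ite ?_ (ha s hst) measurable_const
  have h : {ω | s + leadTime b (fun u => R u ω) s = t}
      = {ω | leadTime b (fun u => R u ω) s = t - s} := by
    ext ω
    simp only [Set.mem_ofPred_eq]
    omega
  rw [h]
  exact measurableSet_leadTime_eq b fun u hu => hR u (by omega)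

lemma measurable_onHand (b : Bool) {t : ℕ} (hD : ∀ u < t, Measurable (D u))
    (hR : ∀ u < t, Measurable (R u)) (ha : ∀ u < t, Measurable (a u)) :
    Measurable fun ω => onHand (fun s => (D s ω).val) (fun s => a s ω)
      (leadTime b fun s => R s ω) t := by
  induction t with
  | zero => exact measurable_const
  | succ t ih =>
    simp only [onHand]
    exact ((ih (fun u hu => hD u (by omega)) (fun u hu => hR u (by omega))
      fun u hu => ha u (by omega)).add (measurable_received b (fun u hu => hR u (by omega))
        fun u hu => ha u (by omega))).sub (measurable_from_top.comp (hD t (by omega)))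

lemma measurable_available (b : Bool) {t : ℕ} (hD : ∀ u < t, Measurable (D u))
    (hR : ∀ u ≤ t, Measurable (R u)) (ha : ∀ u ≤ t, Measurable (a u)) :
    Measurable fun ω => available (fun s => (D s ω).val) (fun s => a s ω)
      (leadTime b fun s => R s ω) t :=
  (measurable_onHand b hD (fun u hu => hR u hu.le) fun u hu => ha u hu.le).add
    (measurable_received b hR ha)

end Measurability

lemma measureReal_setOf_eq_sum {Ω : Type*} [MeasurableSpace Ω] {P : Measure Ω}
    [IsFiniteMeasure P] {n : ℕ} {X : Ω → Fin n} (hX : Measurable X) (Q : Fin n → Prop)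
    [DecidablePred Q] :
    P.real {ω | Q (X ω)} = ∑ d, if Q d then P.real {ω | X ω = d} else 0 := by
  rw [← Finset.sum_filter]
  have h : {ω | Q (X ω)} = ⋃ d ∈ Finset.univ.filter Q, {ω | X ω = d} := by
    ext ω
    simp
  rw [h, measureReal_biUnion_finset]
  · intro d _ e _ hde
    exact Set.disjoint_left.2 fun ω h1 h2 => hde (h1.symm.trans h2)
  · exact fun d _ => hX (measurableSet_singleton d)

/-- When the stock exceeds `x`, sales equal `x` exactly when the demand does. The censored count
becomes a selection by stock followed by a test of the true demand. -/
lemma eventCount_sales_eq {Ω : Type*} {D : ℕ → Ω → Fin (M.Dmax + 1)}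
    {a : ℕ → Ω → ℕ} (j : Fin M.K) (x t : ℕ) (ℓ : Ω → ℕ → ℕ) (ω : Ω) :
    (M.eventCount (sales (fun s => (D s ω).val) (fun s => a s ω) (ℓ ω))
      (available (fun s => (D s ω).val) (fun s => a s ω) (ℓ ω)) t j x : ℝ) =
    selectedCount (fun s ω => (M.phase s = j ∧
      x < available (fun s => (D s ω).val) (fun s => a s ω) (ℓ ω) s) ∧ (D s ω).val = x) t ω := by
  classical
  rw [selectedCount_eq_card, eventCount]
  congr 2
  ext s
  rw [Finset.mem_filter, Finset.mem_filter, and_assoc (a := M.phase s = j)]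
  refine and_congr_right fun _ => and_congr_right fun _ => ?_
  unfold sales
  dsimp only
  omega

lemma riskCount_sales_eq {Ω : Type*} {D : ℕ → Ω → Fin (M.Dmax + 1)}
    {a : ℕ → Ω → ℕ} (j : Fin M.K) (x t : ℕ) (ℓ : Ω → ℕ → ℕ) (ω : Ω) :
    (M.riskCount (sales (fun s => (D s ω).val) (fun s => a s ω) (ℓ ω))
      (available (fun s => (D s ω).val) (fun s => a s ω) (ℓ ω)) t j x : ℝ) =
    selectedCount (fun s ω => (M.phase s = j ∧
      x < available (fun s => (D s ω).val) (fun s => a s ω) (ℓ ω) s) ∧ x ≤ (D s ω).val) t ω := by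
  classical
  rw [selectedCount_eq_card, riskCount]
  congr 2
  ext s
  rw [Finset.mem_filter, Finset.mem_filter, and_assoc (a := M.phase s = j)]
  refine and_congr_right fun _ => and_congr_right fun _ => ?_
  unfold sales
  dsimp only
  omega

/-! ### Strong laws along the operation of the system -/

section Operation

variable {Ω : Type*} [mΩ : MeasurableSpace Ω] {P : Measure Ω}
  {θ : M.Param} {𝓕 : Filtration ℕ mΩ} {D : ℕ → Ω → Fin (M.Dmax + 1)}
  {R : ℕ → Ω → Fin (M.Lmax + 1)} {a : ℕ → Ω → ℕ}

namespace IsOperation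

variable (hop : IsOperation P θ 𝓕 D R a)
include hop

lemma measurable_demand (t : ℕ) : Measurable (D t) := (hop.demand_meas t).mono (𝓕.le _) le_rfl

lemma measurable_driver (t : ℕ) : Measurable (R t) := (hop.driver_meas t).mono (𝓕.le _) le_rfl

lemma measurable_order (t : ℕ) : Measurable (a t) := (hop.order_meas t).mono (𝓕.le _) le_rfl

end IsOperation

/-- The information when the demand of a period occurs: the deliveries of the period are known. -/
def IsOperation.stockFiltration (hop : IsOperation P θ 𝓕 D R a) : Filtration ℕ mΩ where
  seq t := 𝓕 t ⊔ MeasurableSpace.comap (R t) inferInstance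
  mono' := by
    refine monotone_nat_of_le_succ fun t => sup_le ?_ ?_
    · exact (𝓕.mono (Nat.le_succ t)).trans le_sup_left
    · exact (hop.driver_meas t).comap_le.trans le_sup_left
  le' t := sup_le (𝓕.le t) (hop.measurable_driver t).comap_le

namespace IsOperation

/-- The stock of period `t` uses earlier demands but also the deliveries of period `t`, hence the
driver `R t`; this is why `𝓕 t` alone is too small. -/
lemma measurable_available_stockFiltration (hop : IsOperation P θ 𝓕 D R a) (b : Bool) (t : ℕ) :
    Measurable[hop.stockFiltration t] fun ω => available (fun s => (D s ω).val) (fun s => a s ω)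
      (leadTime b fun s => R s ω) t := by
  have hF : 𝓕 t ≤ hop.stockFiltration t := le_sup_left
  refine measurable_available b
    (fun u hu => (hop.demand_meas u).mono ((𝓕.mono hu).trans hF) le_rfl) (fun u hu => ?_)
    fun u hu => (hop.order_meas u).mono ((𝓕.mono hu).trans hF) le_rfl
  rcases hu.lt_or_eq with h | rfl
  · exact (hop.driver_meas u).mono ((𝓕.mono h).trans hF) le_rfl
  · exact (comap_measurable (R u)).mono le_sup_right le_rfl

variable [IsProbabilityMeasure P]

/-- Strong law for the demand in the periods of phase `j` with stock above `x`. -/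
lemma ae_demand_frequency (hop : IsOperation P θ 𝓕 D R a) (j : Fin M.K) (x : ℕ)
    (Q : Fin (M.Dmax + 1) → Prop) [DecidablePred Q] :
    ∀ᵐ ω ∂P, ∀ ε > 0, ∃ C, ∀ t,
      |selectedCount (fun s ω => (M.phase s = j ∧
          x < available (fun s => (D s ω).val) (fun s => a s ω)
            (leadTime θ.crossing fun s => R s ω) s) ∧ Q (D s ω)) t ω -
        (∑ d, if Q d then demandProb θ j d else 0) *
          selectedCount (fun s ω => M.phase s = j ∧
            x < available (fun s => (D s ω).val) (fun s => a s ω)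
              (leadTime θ.crossing fun s => R s ω) s) t ω|
        ≤ C + ε * selectedCount (fun s ω => M.phase s = j ∧
            x < available (fun s => (D s ω).val) (fun s => a s ω)
              (leadTime θ.crossing fun s => R s ω) s) t ω := by
  have hQ : MeasurableSet {d | Q d} := (Set.toFinite _).measurableSet
  refine ae_abs_selectedCount_sub_le (𝓖 := hop.stockFiltration) (E := fun t ω => Q (D t ω))
    (p := fun t => ∑ d, if Q d then demandProb θ (M.phase t) d else 0) (fun t => ?_) (fun t => ?_)
    (fun t => ?_) (fun t A hA => ?_) fun t ω h => ?_
  · exact (MeasurableSet.const _).inter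
      (hop.measurable_available_stockFiltration θ.crossing t (measurableSet_Ioi (a := x)))
  · exact (le_sup_left : 𝓕 (t + 1) ≤ _) _ (hop.demand_meas t hQ)
  · rw [measureReal_setOf_eq_sum (hop.measurable_demand t) Q]
    simp_rw [hop.demand_law]
  · exact measure_inter_eq_mul_of_sup (𝓕.le t) (hop.measurable_demand t) (hop.measurable_driver t)
      (hop.indep_past t) (hop.indep_driver t) hQ hA
  · simp only [h.1]

/-- Strong law for the lead-time driver in adaptively selected periods. -/
lemma ae_driver_frequency (hop : IsOperation P θ 𝓕 D R a) {V : ℕ → Ω → Prop}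
    (hV : ∀ t, MeasurableSet[𝓕 t] {ω | V t ω})
    (Q : Fin (M.Lmax + 1) → Prop) [DecidablePred Q] :
    ∀ᵐ ω ∂P, ∀ ε > 0, ∃ C, ∀ t,
      |selectedCount (fun s ω => V s ω ∧ Q (R s ω)) t ω -
        (∑ i, if Q i then driverProb θ i else 0) * selectedCount V t ω|
        ≤ C + ε * selectedCount V t ω := by
  have hQ : MeasurableSet {d | Q d} := (Set.toFinite _).measurableSet
  refine ae_abs_selectedCount_sub_le (𝓖 := 𝓕) (E := fun t ω => Q (R t ω))
    (p := fun _ => ∑ i, if Q i then driverProb θ i else 0) hV (fun t => hop.driver_meas t hQ)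
    (fun t => ?_) (fun t A hA => ?_) fun t ω h => rfl
  · rw [measureReal_setOf_eq_sum (hop.measurable_driver t) Q]
    simp_rw [hop.driver_law]
  · have h1 := (Indep_iff _ _ _).1 (hop.indep_past t) A _ hA
      ⟨Set.univ ×ˢ {d | Q d}, MeasurableSet.univ.prod hQ, rfl⟩
    have h2 : (fun ω => (D t ω, R t ω)) ⁻¹' (Set.univ ×ˢ {d | Q d}) = {ω | Q (R t ω)} := by
      ext; simp
    rwa [h2] at h1

end IsOperation

lemma IsObservable.frequently (hobs : IsObservable P θ D R a) :
    ∀ᵐ ω ∂P, ∀ (j : Fin M.K), ∀ x < M.Dmax, demandTail θ j x ≠ 0 →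
      ∃ᶠ t in atTop, M.phase t = j ∧
        x < available (fun s => (D s ω).val) (fun s => a s ω)
          (leadTime θ.crossing (fun s => R s ω)) t := by
  filter_upwards [hobs] with ω h j x hx hS
  refine h j ⟨x, by omega⟩ hx ?_
  rw [← demandTail_eq_sum_Ici]
  exact lt_of_le_of_ne (demandTail_nonneg θ j x) hS.symm

variable [IsProbabilityMeasure P]

/-- The observed hazards of the demand converge almost surely, and the number of periods at risk
at such levels is eventually nonzero. -/
theorem IsOperation.ae_hazardsConverge (hop : IsOperation P θ 𝓕 D R a)
    (hobs : IsObservable P θ D R a) :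
    ∀ᵐ ω ∂P,
      HazardsConverge θ
        (sales (fun s => (D s ω).val) (fun s => a s ω) (leadTime θ.crossing fun s => R s ω))
        (available (fun s => (D s ω).val) (fun s => a s ω) (leadTime θ.crossing fun s => R s ω)) ∧
      (0 < M.Dmax → ∀ j, ∀ᶠ t in atTop, M.riskCount
        (sales (fun s => (D s ω).val) (fun s => a s ω) (leadTime θ.crossing fun s => R s ω))
        (available (fun s => (D s ω).val) (fun s => a s ω) (leadTime θ.crossing fun s => R s ω))
        t j 0 ≠ 0) := by
  have h1 := ae_all_iff.2 fun j => ae_all_iff.2 fun x : ℕ =>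
    hop.ae_demand_frequency j x fun d => d.val = x
  have h2 := ae_all_iff.2 fun j => ae_all_iff.2 fun x : ℕ =>
    hop.ae_demand_frequency j x fun d => x ≤ d.val
  filter_upwards [h1, h2, hobs.frequently] with ω h1 h2 h3
  constructor
  · intro j x hx hS
    have hN := tendsto_selectedCount
      (V := fun s ω => M.phase s = j ∧ x < available (fun s => (D s ω).val) (fun s => a s ω)
        (leadTime θ.crossing fun s => R s ω) s) (h3 j x hx hS)
    have he := tendsto_div_of_forall_le hN (h1 j x)
    have hr := tendsto_div_of_forall_le hN (h2 j x)
    have hq : (∑ d : Fin (M.Dmax + 1), if d.val = x then demandProb θ j d else 0)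
        = demandTail θ j x - demandTail θ j (x + 1) := by
      rw [demandTail_sub_succ θ j ⟨x, by omega⟩, Finset.sum_eq_single ⟨x, by omega⟩]
      · simp
      · exact fun b _ hb => if_neg fun h => hb (Fin.ext h)
      · simp
    rw [hq] at he
    have := tendsto_div_of_tendsto_div hN he hr hS
    rw [show (1 : ℝ) - demandTail θ j (x + 1) / demandTail θ j x
      = (demandTail θ j x - demandTail θ j (x + 1)) / demandTail θ j x by field_simp]
    refine this.congr fun t => ?_
    rw [← eventCount_sales_eq j x t (fun ω => leadTime θ.crossing fun s => R s ω) ω,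
      ← riskCount_sales_eq j x t (fun ω => leadTime θ.crossing fun s => R s ω) ω]
  · intro hD j
    have hN := tendsto_selectedCount
      (V := fun s ω => M.phase s = j ∧ 0 < available (fun s => (D s ω).val) (fun s => a s ω)
        (leadTime θ.crossing fun s => R s ω) s)
      (h3 j 0 hD (by rw [demandTail_zero]; exact one_ne_zero))
    filter_upwards [hN.eventually_gt_atTop 0] with t ht h0
    have h4 := riskCount_sales_eq (D := D) (a := a) j 0 t
      (fun ω => leadTime θ.crossing fun s => R s ω) ω
    -- At level `0` every demand passes the test, so the risk count is the number of periods of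
    -- phase `j` with positive stock.
    rw [h0] at h4
    simp only [Nat.zero_le, and_true, Nat.cast_zero] at h4
    exact ht.ne h4

/-- Otherwise all demand mass would sit at zero and the mean would vanish. -/
lemma demandTail_one_pos (hmom : HasDemandMoments θ) {j : Fin M.K} (hj : 0 < θ.mean j) :
    0 < demandTail θ j 1 := by
  refine lt_of_le_of_ne (demandTail_nonneg θ j 1) fun h => hj.ne ?_
  rw [← (hmom j).1]
  refine (Finset.sum_eq_zero fun d _ => ?_).symm
  by_cases hd : d.val = 0
  · simp [hd]
  · have h1 : demandTail θ j d = 0 :=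
      le_antisymm (h ▸ demandTail_anti θ j (by omega)) (demandTail_nonneg θ j _)
    rw [← demandTail_sub_succ, h1, demandTail_succ_eq_zero h1, sub_zero, zero_mul]

/-- Almost surely, infinitely many nonzero orders are placed. -/
theorem IsOperation.ae_tendsto_orderCount (hop : IsOperation P θ 𝓕 D R a)
    (hobs : IsObservable P θ D R a) (hmom : HasDemandMoments θ) (hpos : ∀ j, 0 < θ.mean j) :
    ∀ᵐ ω ∂P, Tendsto (fun t => (orderCount (fun s => a s ω) t : ℝ)) atTop atTop := by
  -- One phase suffices: positive stock occurs in it infinitely often, and a positive fraction of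
  -- those periods has positive demand, hence positive sales.
  have h1 := hop.ae_demand_frequency (M.phase 0) 0 fun d => 1 ≤ d.val
  have hp := demandTail_one_pos hmom (hpos (M.phase 0))
  have hD : 0 < M.Dmax := by
    by_contra h
    exact hp.ne' (demandTail_of_Dmax_lt θ _ (by omega))
  filter_upwards [h1, hobs.frequently] with ω h1 h3
  have hN := tendsto_selectedCount
    (V := fun s ω => M.phase s = M.phase 0 ∧ 0 < available (fun s => (D s ω).val)
      (fun s => a s ω) (leadTime θ.crossing fun s => R s ω) s)
    (h3 (M.phase 0) 0 hD (by rw [demandTail_zero]; exact one_ne_zero))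
  have hr := tendsto_div_of_forall_le hN h1
  have hinf := (hr.pos_mul_atTop (C := demandTail θ (M.phase 0) 1) hp hN).congr'
    ((hN.eventually_gt_atTop 0).mono fun t ht => div_mul_cancel₀ _ ht.ne')
  have hsales : ∃ᶠ t in atTop, 0 < sales (fun s => (D s ω).val) (fun s => a s ω)
      (leadTime θ.crossing fun s => R s ω) t := by
    intro hcon
    obtain ⟨T, hT⟩ := eventually_atTop.1 hcon
    obtain ⟨t, ht⟩ := (hinf.eventually_gt_atTop (T : ℝ)).exists
    classical
    rw [selectedCount_eq_card, Nat.cast_lt] at ht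
    refine ht.not_ge ((Finset.card_le_card fun s hs => ?_).trans (Finset.card_range T).le)
    rw [Finset.mem_range]
    by_contra hc
    refine hT s (not_lt.1 hc) ?_
    rw [Finset.mem_filter] at hs
    have := hs.2
    exact lt_min this.2 this.1.2
  have := tendsto_selectedCount (V := fun t (_ : Unit) => 0 < a t ω) (ω := ())
    (frequently_order_pos hsales)
  refine this.congr fun t => ?_
  rw [selectedCount_eq_card, orderCount]

/-- Without crossing, the driver probabilities are the increments of the hazard, so the sum
telescopes. -/
lemma sum_driverProb_eq_hazard (hc : θ.crossing = false) {n : ℕ} (hn : n < M.Lmax + 1) :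
    (∑ r : Fin (M.Lmax + 1), if r.val ≤ n then driverProb θ r else 0) = hazard θ ⟨n, hn⟩ := by
  induction n with
  | zero =>
    rw [Finset.sum_eq_single ⟨0, hn⟩]
    · simp [driverProb, hc]
    · exact fun b _ hb => if_neg fun h => hb (Fin.ext (Nat.le_zero.1 h))
    · simp
  | succ n ih =>
    have h1 : (∑ r : Fin (M.Lmax + 1), if r.val ≤ n + 1 then driverProb θ r else 0)
        - (∑ r : Fin (M.Lmax + 1), if r.val ≤ n then driverProb θ r else 0)
        = driverProb θ ⟨n + 1, hn⟩ := by
      rw [← Finset.sum_sub_distrib, Finset.sum_eq_single ⟨n + 1, hn⟩]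
      · simp
      · intro b _ hb
        have : b.val ≠ n + 1 := fun h => hb (Fin.ext h)
        split_ifs <;> first | omega | simp
      · simp
    have h2 : Finset.univ.filter (fun k : Fin (M.Lmax + 1) => k.val + 1 = n + 1)
        = {⟨n, by omega⟩} := by
      ext k
      simp [Fin.ext_iff]
    rw [ih (by omega)] at h1
    have h3 : driverProb θ ⟨n + 1, hn⟩ = hazard θ ⟨n + 1, hn⟩ - hazard θ ⟨n, by omega⟩ := by
      simp only [driverProb, hc, Bool.false_eq_true, if_false, h2, Finset.sum_singleton]
    linarith

/-- Almost surely, the lead-time frequencies among the nonzero orders converge. -/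
theorem IsOperation.ae_tendsto_leadCount (hop : IsOperation P θ 𝓕 D R a)
    (hlead : θ.lead ∈ stdSimplex ℝ (Fin (M.Lmax + 1))) :
    ∀ᵐ ω ∂P, Tendsto (fun t => (orderCount (fun s => a s ω) t : ℝ)) atTop atTop →
      ∀ i : Fin (M.Lmax + 1), Tendsto (fun t =>
        (leadCount (fun s => a s ω) (leadTime θ.crossing fun s => R s ω) i t : ℝ) /
          (orderCount (fun s => a s ω) t : ℝ)) atTop (𝓝 (θ.lead i)) := by
  classical
  cases hc : θ.crossing
  -- Selection is indexed by the testing period `t`: the order of period `t - i` is nonzero and has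
  -- survived to age `i`, which is known in `𝓕 t`, before `R t`.
  · set V : ℕ → ℕ → Ω → Prop := fun i t ω =>
      i ≤ t ∧ 0 < a (t - i) ω ∧ ∀ k < i, k < (R (t - i + k) ω).val with hVdef
    have hV : ∀ i t, MeasurableSet[𝓕 t] {ω | V i t ω} := fun i t => by
      by_cases hit : i ≤ t
      · have h1 : MeasurableSet[𝓕 t] {ω | ∀ k < i, k < (R (t - i + k) ω).val} := by
          simp only [Set.ofPred_forall]
          exact MeasurableSet.iInter fun k => MeasurableSet.iInter fun hk =>
            measurableSet_lt_driver ((hop.driver_meas _).mono (𝓕.mono (by omega)) le_rfl)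
        simp only [hVdef, hit, true_and]
        exact MeasurableSet.inter (((hop.order_meas _).mono (𝓕.mono (by omega)) le_rfl)
          (measurableSet_Ioi (a := 0))) h1
      · simp [hVdef, hit]
    have hlaw := ae_all_iff.2 fun i : Fin (M.Lmax + 1) =>
      hop.ae_driver_frequency (hV i) fun r => r.val ≤ i.val
    filter_upwards [hlaw] with ω hω hN
    set o : ℕ → ℕ := fun s => a s ω
    set ℓ : ℕ → ℕ := leadTime false fun s => R s ω with hℓ
    set A : ℕ → ℕ → ℕ := fun i T => ((Finset.range T).filter fun s => 0 < o s ∧ i ≤ ℓ s).card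
      with hA
    have hsplit : ∀ i T, A i T = leadCount o ℓ i T + A (i + 1) T := fun i T => by
      simp only [hA, leadCount]
      rw [← Finset.card_union_of_disjoint]
      · congr 1
        ext s
        simp only [Finset.mem_filter, Finset.mem_union]
        constructor
        · rintro ⟨h1, h2, h3⟩
          rcases h3.eq_or_lt with h | h
          · exact Or.inl ⟨h1, h2, h.symm⟩
          · exact Or.inr ⟨h1, h2, h⟩
        · rintro (⟨h1, h2, h3⟩ | ⟨h1, h2, h3⟩)
          · exact ⟨h1, h2, h3.ge⟩
          · exact ⟨h1, h2, by omega⟩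
      · refine Finset.disjoint_filter.2 fun s _ h1 h2 => ?_
        omega
    have hAcount : ∀ i T, selectedCount (V i) (T + i) ω = A i T := fun i T => by
      rw [selectedCount_add (fun s hs h => absurd h.1 (not_le.2 hs)), selectedCount_eq_card]
      congr 2
      refine Finset.filter_congr fun s _ => ?_
      simp only [hVdef, hℓ, le_leadTime_false_iff, Nat.add_sub_cancel, Nat.le_add_left,
        true_and, o]
    have hBcount : ∀ i T, selectedCount (fun t ω => V i t ω ∧ (R t ω).val ≤ i) (T + i) ω
        = leadCount o ℓ i T := fun i T => by
      rw [selectedCount_add (fun s hs h => absurd h.1.1 (not_le.2 hs)), selectedCount_eq_card,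
        leadCount]
      congr 2
      refine Finset.filter_congr fun s _ => ?_
      simp only [hVdef, hℓ, leadTime_false_eq_iff, Nat.add_sub_cancel, Nat.le_add_left,
        true_and, o, and_assoc]
    -- Among the survivors to age `i`, the fraction received is the hazard up to an error negligible
    -- against all orders, so a tail limit yields a probability limit.
    have hB : ∀ i : Fin (M.Lmax + 1),
        Tendsto (fun T => (A i T : ℝ) / (orderCount o T : ℝ)) atTop (𝓝 (leadTail θ i)) →
        Tendsto (fun T => (leadCount o ℓ i T : ℝ) / (orderCount o T : ℝ)) atTop
          (𝓝 (θ.lead i)) := fun i hAi => by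
      have h1 := tendsto_sub_div_of_forall_le (B := fun T => (leadCount o ℓ i T : ℝ))
        (S := fun T => (A i T : ℝ)) (q := hazard θ i) hN
        (fun T => Nat.cast_le.2 (Finset.card_le_card fun s hs => by
          simp only [Finset.mem_filter] at hs ⊢
          exact ⟨hs.1, hs.2.1⟩))
        (fun ε hε => by
          obtain ⟨C, hC⟩ := hω i ε hε
          refine ⟨C, fun T => ?_⟩
          have := hC (T + i)
          rwa [hBcount, hAcount, sum_driverProb_eq_hazard hc i.isLt] at this)
      have h2 := h1.add (hAi.const_mul (hazard θ i))
      rw [zero_add, hazard_mul_leadTail hlead] at h2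
      refine h2.congr fun T => ?_
      ring
    -- Induction on the age: the survivors to `n + 1` are those to `n` minus the orders received at
    -- age `n`.
    have hAlim : ∀ n, n < M.Lmax + 1 →
        Tendsto (fun T => (A n T : ℝ) / (orderCount o T : ℝ)) atTop (𝓝 (leadTail θ n)) := by
      intro n
      induction n with
      | zero =>
        intro _
        have h0 : leadTail θ 0 = 1 := by simpa [leadTail] using hlead.2
        rw [h0]
        refine tendsto_const_nhds.congr' ?_
        filter_upwards [hN.eventually_gt_atTop 0] with T hT
        have : A 0 T = orderCount o T := by simp [hA, orderCount]
        rw [this, div_self hT.ne']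
      | succ n ih =>
        intro hn
        have h1 := ih (by omega)
        have h2 := h1.sub (hB ⟨n, by omega⟩ h1)
        rw [← leadTail_sub_succ θ ⟨n, by omega⟩] at h2
        simp only [sub_sub_cancel] at h2
        refine h2.congr fun T => ?_
        rw [hsplit n T]
        push_cast
        ring
    exact fun i => hB i (hAlim i i.isLt)
  -- With crossing, the driver of a period is the lead time of its order, so a single application of
  -- the strong law to the nonzero orders suffices.
  · have hlaw := ae_all_iff.2 fun i : Fin (M.Lmax + 1) =>
      hop.ae_driver_frequency (V := fun t ω => 0 < a t ω)
        (fun t => hop.order_meas t (measurableSet_Ioi (a := 0))) fun r => r = i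
    filter_upwards [hlaw] with ω hω hN i
    have h1 : ∀ t, selectedCount (fun t ω => 0 < a t ω) t ω = orderCount (fun s => a s ω) t :=
      fun t => by rw [selectedCount_eq_card, orderCount]
    have h2 : ∀ t, selectedCount (fun t ω => 0 < a t ω ∧ R t ω = i) t ω
        = leadCount (fun s => a s ω) (leadTime true fun s => R s ω) i t := fun t => by
      rw [selectedCount_eq_card, leadCount]
      congr! 4
      simp [leadTime, Fin.ext_iff]
    have h3 := tendsto_div_of_forall_le (N := fun t => (orderCount (fun s => a s ω) t : ℝ)) hN
      (by simpa only [h1] using hω i)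
    simpa [h2, driverProb, hc] using h3

end Operation

end LostSales

/-! ### The parameterization distance of a Lipschitz Super-MDP -/

namespace SuperMDP

variable {Θ X S : Type}

lemma costMax_nonneg (M : SuperMDP Θ X S) (θ θ' : Θ) : 0 ≤ M.costMax θ θ' :=
  le_max_of_le_left (Real.iSup_nonneg fun _ => abs_nonneg _)

variable [Fintype S]

lemma transDist_nonneg (M : SuperMDP Θ X S) (θ θ' : Θ) (x : X) : 0 ≤ M.transDist θ θ' x :=
  Finset.sum_nonneg fun _ _ => abs_nonneg _

lemma paramDist_nonneg (M : SuperMDP Θ X S) (θ θ' : Θ) : 0 ≤ M.paramDist θ θ' :=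
  Real.iSup_nonneg fun x =>
    add_nonneg (abs_nonneg _) (mul_nonneg (M.costMax_nonneg θ θ') (M.transDist_nonneg θ θ' x))

/-- `costMax` also involves `θ'`, but the cost Lipschitz bound controls it by the largest cost at
`θ`. For fixed `θ` the bound depends on `δ` alone. Absolute values appear because the constants have
no prescribed sign. -/
lemma IsLipschitz.paramDist_le [Finite X] {M : SuperMDP Θ X S} {d : Θ → Θ → ℝ} {Lf Lr : ℝ}
    (h : M.IsLipschitz d Lf Lr) {θ θ' : Θ} (hθ : θ ∈ M.space) (hθ' : θ' ∈ M.space) {δ : ℝ}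
    (h0 : 0 ≤ d θ θ') (hδ : d θ θ' ≤ δ) :
    M.paramDist θ θ' ≤ |Lr| * δ + ((⨆ x, |M.cost θ x|) + |Lr| * δ) * (|Lf| * δ) := by
  have hδ0 : 0 ≤ δ := h0.trans hδ
  have hmul : ∀ L : ℝ, L * d θ θ' ≤ |L| * δ := fun L =>
    (mul_le_mul_of_nonneg_right (le_abs_self L) h0).trans
      (mul_le_mul_of_nonneg_left hδ (abs_nonneg L))
  have hc0 : 0 ≤ ⨆ x, |M.cost θ x| := Real.iSup_nonneg fun _ => abs_nonneg _
  have hcost : ∀ x, |M.cost θ x - M.cost θ' x| ≤ |Lr| * δ := fun x =>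
    (h θ hθ θ' hθ' x).1.trans (hmul Lr)
  have hmax : M.costMax θ θ' ≤ (⨆ x, |M.cost θ x|) + |Lr| * δ := by
    refine max_le (le_add_of_nonneg_right (by positivity)) (Real.iSup_le (fun x => ?_)
      (by positivity))
    have h1 : |M.cost θ x| ≤ ⨆ x, |M.cost θ x| :=
      le_ciSup (f := fun x => |M.cost θ x|) (Set.finite_range _).bddAbove x
    have h2 := abs_sub_abs_le_abs_sub (M.cost θ' x) (M.cost θ x)
    rw [abs_sub_comm] at h2
    linarith [hcost x]
  refine Real.iSup_le (fun x => ?_) (by positivity)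
  exact add_le_add (hcost x) (mul_le_mul hmax ((h θ hθ θ' hθ' x).2.trans (hmul Lf))
    (M.transDist_nonneg θ θ' x) (by positivity))

end SuperMDP

namespace LostSales

variable {M : LostSales}

instance instFiniteStateAction : Finite M.StateAction :=
  inferInstanceAs (Finite {sa : M.State × Fin (M.m + 1) //
    sa.1.1.1 + ∑ i, sa.1.1.2.1 i + sa.2.val ≤ M.I})

/-! ### The `ℓ¹` metric and the projection -/

lemma dist₁_nonneg (θ θ' : M.Param) : 0 ≤ dist₁ θ θ' := by
  unfold dist₁
  have : (0 : ℝ) ≤ if θ.crossing = θ'.crossing then 0 else 1 := by split_ifs <;> simp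
  positivity

lemma dist₁_comm (θ θ' : M.Param) : dist₁ θ θ' = dist₁ θ' θ := by
  simp only [dist₁, abs_sub_comm θ.h, abs_sub_comm θ.p, fun j => abs_sub_comm (θ.mean j),
    fun j => abs_sub_comm (θ.std j), fun j => abs_sub_comm (θ.lead j), eq_comm (a := θ.crossing)]

lemma dist₁_triangle (θ₁ θ₂ θ₃ : M.Param) : dist₁ θ₁ θ₃ ≤ dist₁ θ₁ θ₂ + dist₁ θ₂ θ₃ := by
  have h1 : ∑ j, (|θ₁.mean j - θ₃.mean j| + |θ₁.std j - θ₃.std j|) ≤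
      ∑ j, (|θ₁.mean j - θ₂.mean j| + |θ₁.std j - θ₂.std j|) +
        ∑ j, (|θ₂.mean j - θ₃.mean j| + |θ₂.std j - θ₃.std j|) := by
    rw [← Finset.sum_add_distrib]
    refine Finset.sum_le_sum fun j _ => ?_
    linarith [abs_sub_le (θ₁.mean j) (θ₂.mean j) (θ₃.mean j),
      abs_sub_le (θ₁.std j) (θ₂.std j) (θ₃.std j)]
  have h2 : ∑ i, |θ₁.lead i - θ₃.lead i| ≤
      ∑ i, |θ₁.lead i - θ₂.lead i| + ∑ i, |θ₂.lead i - θ₃.lead i| := by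
    rw [← Finset.sum_add_distrib]
    exact Finset.sum_le_sum fun i _ => abs_sub_le _ _ _
  have h3 : (if θ₁.crossing = θ₃.crossing then (0 : ℝ) else 1) ≤
      (if θ₁.crossing = θ₂.crossing then 0 else 1) +
        if θ₂.crossing = θ₃.crossing then 0 else 1 := by
    split_ifs <;> simp_all
  unfold dist₁
  linarith [abs_sub_le θ₁.h θ₂.h θ₃.h, abs_sub_le θ₁.p θ₂.p θ₃.p]

lemma SameKnown.rawEstimate (θ θ₀ : M.Param) (z y a ℓ : ℕ → ℕ) (t : ℕ) :
    SameKnown (rawEstimate θ θ₀ z y a ℓ t) θ := ⟨rfl, rfl, rfl⟩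

/-- `θ` itself competes in the minimization, so the projection moves `θ'` by at most its distance to
`θ`; the triangle inequality gives the factor `2`. -/
lemma IsProjection.dist₁_le {Phat : Set M.Param} {proj : M.Param → M.Param}
    (hproj : IsProjection Phat proj) {θ θ' : M.Param} (hθ : θ ∈ Phat) (h : SameKnown θ' θ) :
    dist₁ θ (proj θ') ≤ 2 * dist₁ θ θ' := by
  have h1 := (hproj θ' ⟨θ, hθ, h⟩).2.2 θ hθ h
  rw [dist₁_comm θ' θ] at h1
  linarith [dist₁_triangle θ θ' (proj θ')]

lemma dist₁_rawEstimate (θ θ₀ : M.Param) (z y a ℓ : ℕ → ℕ) (t : ℕ) :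
    dist₁ θ (rawEstimate θ θ₀ z y a ℓ t) =
      ∑ j, (|θ.mean j - (rawEstimate θ θ₀ z y a ℓ t).mean j| +
        |θ.std j - (rawEstimate θ θ₀ z y a ℓ t).std j|) +
      ∑ i, |θ.lead i - (rawEstimate θ θ₀ z y a ℓ t).lead i| := by
  simp [dist₁, LostSales.rawEstimate]

/-- The raw estimate converges when the observed hazards and lead-time frequencies do. -/
lemma HazardsConverge.tendsto_dist₁_rawEstimate {θ : M.Param} (θ₀ : M.Param) {z y a ℓ : ℕ → ℕ}
    (h : HazardsConverge θ z y) (hmom : HasDemandMoments θ)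
    (hrisk : ∀ j, ∀ᶠ t in atTop, M.riskCount z y t j 0 ≠ 0)
    (hrec : ∀ᶠ t in atTop, (receivedOrders a ℓ t).card ≠ 0)
    (hlead : ∀ i : Fin (M.Lmax + 1), Tendsto (fun t =>
      (((receivedOrders a ℓ t).filter fun s => ℓ s = i.val).card : ℝ) /
        ((receivedOrders a ℓ t).card : ℝ)) atTop (𝓝 (θ.lead i))) :
    Tendsto (fun t => dist₁ θ (rawEstimate θ θ₀ z y a ℓ t)) atTop (𝓝 0) := by
  have habs : ∀ {f : ℕ → ℝ} {c : ℝ}, Tendsto f atTop (𝓝 c) →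
      Tendsto (fun t => |c - f t|) atTop (𝓝 0) := fun {f c} hf => by
    simpa using (hf.const_sub c).abs
  simp_rw [dist₁_rawEstimate]
  rw [show (0 : ℝ) = ∑ _j : Fin M.K, (0 + 0) + ∑ _i : Fin (M.Lmax + 1), 0 by simp]
  refine (tendsto_finsetSum _ fun j _ => Tendsto.add (habs ?_) (habs ?_)).add
    (tendsto_finsetSum _ fun i _ => habs ?_)
  -- The provisional values are in use only finitely often.
  · refine (h.tendsto_kmMean hmom j).congr' ((hrisk j).mono fun t ht => ?_)
    simp [LostSales.rawEstimate, ht]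
  · refine (h.tendsto_kmStd hmom j).congr' ((hrisk j).mono fun t ht => ?_)
    simp [LostSales.rawEstimate, ht]
  · refine (hlead i).congr' (hrec.mono fun t ht => ?_)
    simp only [LostSales.rawEstimate, if_neg ht]

/-! ### Measurability of the estimates -/

section Measurability

variable {Ω : Type*} [MeasurableSpace Ω] {z y a ℓ : ℕ → Ω → ℕ}

lemma measurable_card_filter {p : ℕ → Ω → Prop} [∀ s ω, Decidable (p s ω)]
    (hp : ∀ s, MeasurableSet {ω | p s ω}) (T : Finset ℕ) :
    Measurable fun ω => (T.filter fun s => p s ω).card := by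
  simp_rw [Finset.card_filter]
  exact Finset.measurable_fun_sum _ fun s _ =>
    Measurable.ite (hp s) measurable_const measurable_const

lemma measurable_eventCount (hz : ∀ s, Measurable (z s)) (hy : ∀ s, Measurable (y s)) (t : ℕ)
    (j : Fin M.K) (x : ℕ) :
    Measurable fun ω => M.eventCount (fun s => z s ω) (fun s => y s ω) t j x := by
  refine measurable_card_filter (fun s => ?_) _
  exact (MeasurableSet.const _).inter
    ((hz s (measurableSet_singleton x)).inter (hy s (measurableSet_Ioi (a := x))))

lemma measurable_riskCount (hz : ∀ s, Measurable (z s)) (hy : ∀ s, Measurable (y s)) (t : ℕ)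
    (j : Fin M.K) (x : ℕ) :
    Measurable fun ω => M.riskCount (fun s => z s ω) (fun s => y s ω) t j x := by
  refine measurable_card_filter (fun s => ?_) _
  exact (MeasurableSet.const _).inter
    ((hz s (measurableSet_Ici (a := x))).inter (hy s (measurableSet_Ioi (a := x))))

lemma measurable_kmMass (hz : ∀ s, Measurable (z s)) (hy : ∀ s, Measurable (y s)) (t : ℕ)
    (j : Fin M.K) (x : ℕ) :
    Measurable fun ω => M.kmMass (fun s => z s ω) (fun s => y s ω) t j x := by
  have h : ∀ x, Measurable fun ω => M.kaplanMeier (fun s => z s ω) (fun s => y s ω) t j x := by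
    intro x
    unfold kaplanMeier
    split_ifs
    · exact measurable_const
    · exact (Finset.measurable_fun_prod _ fun i _ =>
        ((measurable_from_top.comp (measurable_eventCount hz hy t j i)).div
          (measurable_from_top.comp (measurable_riskCount hz hy t j i))).const_sub 1).const_sub 1
  unfold kmMass
  split_ifs
  · exact (h x).sub_const _
  · exact (h x).sub (h _)

lemma measurable_kmMean (hz : ∀ s, Measurable (z s)) (hy : ∀ s, Measurable (y s)) (t : ℕ)
    (j : Fin M.K) : Measurable fun ω => M.kmMean (fun s => z s ω) (fun s => y s ω) t j :=
  Finset.measurable_fun_sum _ fun x _ => (measurable_kmMass hz hy t j x).mul_const _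

lemma measurable_kmStd (hz : ∀ s, Measurable (z s)) (hy : ∀ s, Measurable (y s)) (t : ℕ)
    (j : Fin M.K) : Measurable fun ω => M.kmStd (fun s => z s ω) (fun s => y s ω) t j :=
  (Finset.measurable_fun_sum _ fun x _ => (measurable_kmMass hz hy t j x).mul
    (((measurable_kmMean hz hy t j).const_sub _).pow_const 2)).sqrt

lemma measurable_dist₁_rawEstimate (θ θ₀ : M.Param) (hz : ∀ s, Measurable (z s))
    (hy : ∀ s, Measurable (y s)) (ha : ∀ s, Measurable (a s)) (hℓ : ∀ s, Measurable (ℓ s))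
    (t : ℕ) :
    Measurable fun ω => dist₁ θ (rawEstimate θ θ₀ (fun s => z s ω) (fun s => y s ω)
      (fun s => a s ω) (fun s => ℓ s ω) t) := by
  simp_rw [dist₁_rawEstimate]
  have hrisk : ∀ j, MeasurableSet {ω | M.riskCount (fun s => z s ω) (fun s => y s ω) t j 0 = 0} :=
    fun j => measurable_riskCount hz hy t j 0 (measurableSet_singleton 0)
  have hset : ∀ s, MeasurableSet {ω | 0 < a s ω ∧ s + ℓ s ω < t} := fun s =>
    (ha s (measurableSet_Ioi (a := 0))).inter
      (((hℓ s).const_add s) (measurableSet_Iio (a := t)))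
  have hrec : Measurable fun ω => (receivedOrders (fun s => a s ω) (fun s => ℓ s ω) t).card :=
    measurable_card_filter hset _
  have hreci : ∀ i : ℕ, Measurable fun ω =>
      ((receivedOrders (fun s => a s ω) (fun s => ℓ s ω) t).filter fun s => ℓ s ω = i).card :=
    fun i => by
      unfold receivedOrders
      simp_rw [Finset.filter_filter]
      refine measurable_card_filter (fun s => ?_) _
      exact (hset s).inter (hℓ s (measurableSet_singleton i))
  refine (Finset.measurable_fun_sum _ fun j _ => Measurable.add ?_ ?_).add
    (Finset.measurable_fun_sum _ fun i _ => ?_)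
  · exact (Measurable.const_sub (Measurable.ite (hrisk j) measurable_const
      (measurable_kmMean hz hy t j)) _).abs
  · exact (Measurable.const_sub (Measurable.ite (hrisk j) measurable_const
      (measurable_kmStd hz hy t j)) _).abs
  · refine (Measurable.const_sub (Measurable.ite (hrec (measurableSet_singleton 0))
      measurable_const ?_) _).abs
    refine Measurable.div ?_ (measurable_from_top.comp hrec)
    have hcast : Measurable fun n : ℕ => (n : ℝ) := measurable_from_top
    convert hcast.comp (hreci i.val)
    simp only [Function.comp_apply]

end Measurability

/-! ### Convergence of the raw estimates and consistency in the parameterization distance -/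

section Consistency

variable {Ω : Type*} [mΩ : MeasurableSpace Ω] {P : Measure Ω} {θ : M.Param}
  {𝓕 : Filtration ℕ mΩ} {D : ℕ → Ω → Fin (M.Dmax + 1)}
  {R : ℕ → Ω → Fin (M.Lmax + 1)} {a : ℕ → Ω → ℕ}

lemma IsOperation.measurable_dist₁_rawEstimate (hop : IsOperation P θ 𝓕 D R a) (θ₀ : M.Param)
    (t : ℕ) :
    Measurable fun ω => dist₁ θ (rawEstimate θ θ₀
      (sales (fun s => (D s ω).val) (fun s => a s ω) (leadTime θ.crossing fun s => R s ω))
      (available (fun s => (D s ω).val) (fun s => a s ω) (leadTime θ.crossing fun s => R s ω))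
      (fun s => a s ω) (leadTime θ.crossing fun s => R s ω) t) := by
  have hy : ∀ s, Measurable fun ω => available (fun s => (D s ω).val) (fun s => a s ω)
      (leadTime θ.crossing fun s => R s ω) s := fun s =>
    measurable_available θ.crossing (fun u _ => hop.measurable_demand u)
      (fun u _ => hop.measurable_driver u) fun u _ => hop.measurable_order u
  refine LostSales.measurable_dist₁_rawEstimate θ θ₀
    (z := fun s ω => sales (fun s => (D s ω).val) (fun s => a s ω)
      (leadTime θ.crossing fun s => R s ω) s)
    (ℓ := fun s ω => leadTime θ.crossing (fun s => R s ω) s)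
    (fun s => ?_) hy hop.measurable_order
    (fun s => measurable_to_countable' fun i =>
      measurableSet_leadTime_eq _ fun u _ => hop.measurable_driver u) t
  exact (measurable_from_top.comp (hop.measurable_demand s)).min (hy s)

/-- The raw estimates converge almost surely in the `ℓ¹` metric. -/
theorem IsOperation.ae_tendsto_dist₁_rawEstimate [IsProbabilityMeasure P]
    (hop : IsOperation P θ 𝓕 D R a) (hobs : IsObservable P θ D R a) (hadm : IsAdmissible θ)
    (hmom : HasDemandMoments θ) (θ₀ : M.Param) :
    ∀ᵐ ω ∂P, Tendsto (fun t => dist₁ θ (rawEstimate θ θ₀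
      (sales (fun s => (D s ω).val) (fun s => a s ω) (leadTime θ.crossing fun s => R s ω))
      (available (fun s => (D s ω).val) (fun s => a s ω) (leadTime θ.crossing fun s => R s ω))
      (fun s => a s ω) (leadTime θ.crossing fun s => R s ω) t)) atTop (𝓝 0) := by
  have hD : 0 < M.Dmax := by
    by_contra h
    exact (demandTail_one_pos hmom (hadm.mean_pos 0)).ne' (demandTail_of_Dmax_lt θ _ (by omega))
  filter_upwards [hop.ae_hazardsConverge hobs,
    hop.ae_tendsto_orderCount hobs hmom hadm.mean_pos,
    hop.ae_tendsto_leadCount hadm.lead_mem] with ω h1 h2 h3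
  obtain ⟨h4, h5⟩ := tendsto_lead_frequency (leadTime_le θ.crossing fun s => R s ω)
    hadm.lead_mem.2 h2 (h3 h2)
  exact h1.1.tendsto_dist₁_rawEstimate θ₀ hmom (h1.2 hD) h4 h5

end Consistency

end LostSales

theorem mainTheorem2 (M : LostSales) (Phat : Set M.Param)
    (hadm : ∀ θ' ∈ Phat, LostSales.IsAdmissible θ')
    (Lf Lr : ℝ) (hLip : (M.superMDP Phat).IsLipschitz LostSales.dist₁ Lf Lr)
    (proj : M.Param → M.Param) (hproj : LostSales.IsProjection Phat proj)
    (θ : M.Param) (hθ : θ ∈ Phat) (hmom : LostSales.HasDemandMoments θ) (θ₀ : M.Param)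
    {Ω : Type*} [mΩ : MeasurableSpace Ω] (P : Measure Ω) [IsProbabilityMeasure P]
    (𝓕 : Filtration ℕ mΩ) (D : ℕ → Ω → Fin (M.Dmax + 1)) (R : ℕ → Ω → Fin (M.Lmax + 1))
    (a : ℕ → Ω → ℕ) (hop : LostSales.IsOperation P θ 𝓕 D R a)
    (hobs : LostSales.IsObservable P θ D R a) :
    (∀ᵐ ω ∂P, Tendsto
      (fun t => (M.superMDP Phat).paramDist θ (LostSales.estimate θ θ₀ proj D R a t ω))
      atTop (𝓝 0)) ∧
    (M.superMDP Phat).IsConsistent P θ (LostSales.estimate θ θ₀ proj D R a) := by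
  set raw : ℕ → Ω → M.Param := fun t ω => LostSales.rawEstimate θ θ₀
    (sales (fun s => (D s ω).val) (fun s => a s ω) (LostSales.leadTime θ.crossing fun s => R s ω))
    (available (fun s => (D s ω).val) (fun s => a s ω)
      (LostSales.leadTime θ.crossing fun s => R s ω))
    (fun s => a s ω) (LostSales.leadTime θ.crossing fun s => R s ω) t with hraw
  set φ : ℝ → ℝ := fun δ =>
    |Lr| * δ + ((⨆ x, |(M.superMDP Phat).cost θ x|) + |Lr| * δ) * (|Lf| * δ) with hφ
  have hφc : Continuous φ := by fun_prop
  have hmem : ∀ t ω, LostSales.estimate θ θ₀ proj D R a t ω ∈ Phat := fun t ω =>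
    (hproj (raw t ω) ⟨θ, hθ, LostSales.SameKnown.rawEstimate ..⟩).1
  have hle : ∀ t ω, (M.superMDP Phat).paramDist θ (LostSales.estimate θ θ₀ proj D R a t ω) ≤
      φ (2 * LostSales.dist₁ θ (raw t ω)) := fun t ω =>
    hLip.paramDist_le hθ (hmem t ω) (LostSales.dist₁_nonneg _ _)
      (hproj.dist₁_le hθ (LostSales.SameKnown.rawEstimate ..))
  have hlim : ∀ᵐ ω ∂P, Tendsto (fun t => φ (2 * LostSales.dist₁ θ (raw t ω))) atTop (𝓝 0) := by
    filter_upwards [hop.ae_tendsto_dist₁_rawEstimate hobs (hadm θ hθ) hmom θ₀] with ω hω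
    have h0 : φ (2 * 0) = 0 := by simp [hφ]
    have := (hφc.tendsto (2 * 0)).comp (hω.const_mul 2)
    rwa [h0] at this
  refine ⟨?_, hmem, fun ε hε => ?_⟩
  · filter_upwards [hlim] with ω hω
    exact squeeze_zero (fun t => SuperMDP.paramDist_nonneg _ _ _) (fun t => hle t ω) hω
  -- The map `proj` is not assumed measurable, so convergence in probability is proved for the
  -- measurable majorant; monotonicity of `P`, valid for arbitrary sets, transfers it to the
  -- estimates.
  · have hmeas : ∀ t, Measurable fun ω => φ (2 * LostSales.dist₁ θ (raw t ω)) := fun t =>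
      hφc.measurable.comp ((hop.measurable_dist₁_rawEstimate θ₀ t).const_mul 2)
    have h1 := tendstoInMeasure_iff_norm.1 (tendstoInMeasure_of_tendsto_ae
      (fun t => (hmeas t).aestronglyMeasurable) hlim) ε hε
    refine tendsto_of_tendsto_of_tendsto_of_le_of_le tendsto_const_nhds h1
      (fun _ => zero_le) fun t => measure_mono fun ω hω => ?_
    have h2 : ε < (M.superMDP Phat).paramDist θ (LostSales.estimate θ θ₀ proj D R a t ω) := hω
    show ε ≤ ‖φ (2 * LostSales.dist₁ θ (raw t ω)) - 0‖
    rw [sub_zero]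
    exact (h2.le.trans (hle t ω)).trans (le_abs_self _)
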